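/- **Setting.** Let $\Bbbk$ be a field of characteristic zero, $Q$ a finite quiver, and $A=\Bbbk Q/I$ with $I$ an admissible ideal generated by its minimal set $\mathcal R$ of paths. Put $E=\Bbbk Q_0$, and let $AP_n$ be the set of supports of $n$-concatenations ($AP_0=Q_0$, $AP_1=Q_1$, $AP_2=\mathcal R$). Let $F_n,G_n$ be the explicit comparison maps between Bardzell's resolution $(A\otimes_E \Bbbk AP_n\otimes_E A)_n$ and the reduced bar resolution $(A\otimes_E(\operatorname{rad}A)^{\otimes_E n}\otimes_E A)_n$ with differential $d_n$, described as follows. For a divisor $\psi$ of a path $w$ write $w=L(\psi)\,\psi\,R(\psi)$, and let $s_n(a\otimes x)=1\otimes a_r\otimes x$, where $a_r$ is the component of $a$ in $\operatorname{rad}A$ along $A=E\oplus\operatorname{rad}A$. * $F_0$ and $F_1$ are the obvious inclusions. For $n\ge 2$, $F_n(1\otimes w\otimes 1)=\sum_\psi s_{n-1}\bigl(L(\psi)F_{n-1}(1\otimes\psi\otimes1)R(\psi)\bigr)$, over all divisors $\psi\in AP_{n-1}$ of $w$ if $n$ is even, and over the one with $w=L(\psi)\psi$ if $n$ is odd. *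 Let $v_1,\dots,v_n$ be composable paths of positive length not in $I$. If $n$ is even, $G_n(1\otimes v_1\otimes\cdots\otimes v_n\otimes 1)=L\otimes w\otimes R$ with $w\in AP_n$ the divisor of $v_1\cdots v_n=LwR$ of smallest start, provided all $v_{2i-1}v_{2i}\in I$ and such a $w$ exists, and $0$ otherwise. If $n$ is odd, it is the sum of the $L\otimes w\otimes R$ over all $w\in AP_n$ with $v_1\cdots v_n=LwR$ that start strictly before the end of $v_1$, provided all $v_{2i}v_{2i+1}\in I$, and $0$ otherwise. * $H_n$ are the $A$-bimodule maps with $H_0=0$ and $H_n(1\otimes x)=(s_nF_nG_n-s_nH_{n-1}d_n)(1\otimes x)$. A linear map $f$ on $(\operatorname{rad}A)^{\otimes_E n}$ or on $\Bbbk AP_n$ with values in $A$ is identified with its $A$-bimodule extension $a\otimes x\otimes b\mapsto a f(x) b$. On cochains set $F^*f=fF$, $G^*f=fG$, and $(-1)^{n-1}H^*f=fH_{n-1}$ for $f$ of arity $n$. Let $[-,-]$ be the Gerstenhaber bracket of reduced cochains, $[f,g]=f\circ g-(-1)^{(n-1)(m-1)}g\circ f$ with $f\circ g=\sum_{i=0}^{n-1}(-1)^{i(m+1)}f(\mathrm{Id}^{\otimes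 i}\otimes g\otimes\mathrm{Id}^{\otimes n-i-1})$ for arities $n,m$, where components in $E$ of an inner argument count as $0$. A cochain of arity $n$ has shifted degree $n-1$. For homogeneous elements of Bardzell's complex define recursively $v_1=u_1=0$, $\phi_1=G^*$ and, for $n\ge2$, $$v_n=\sum_{t=1}^{n-1}\sum_{\tau\in \mathbb S^-_{t,n-t}}\chi(\tau)\kappa(\tau)_t\,[\phi_t,\phi_{n-t}]\hat\tau,\qquad l_n=F^*v_n,$$ $$u_n=\sum_{k=2}^n\sum_{\tau\in \mathbb S_{k,n-k}}(-1)^{k(n-k)+1}\chi(\tau)\,\phi_{n-k+1}(l_k\otimes \mathrm{Id}^{\otimes n-k})\hat\tau,\qquad \phi_n=H^*(u_n+v_n),$$ where $\mathbb S_{t,n-t}$ is the set of $(t,n-t)$-unshuffles, $\mathbb S^-_{t,n-t}$ its subset with $\tau(1)<\tau(t+1)$, $\chi$ is the antisymmetric Koszul sign for the shifted degrees and $\kappa(\tau)_t=(-1)^{(t-1)+(n-t-1)\sum_{p\le t}|f_{\tau(p)}|}$. **Proposition 4.5.** Let $n\ge3$, let $f_1,\dots,f_n\in B^1(A)[1]=\operatorname{Hom}_{E-E}(\Bbbk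 AP_2,A)$, let $\alpha,\beta\in Q_1$, and let $v$ be a path of positive length. Then $$v_n(f_1\otimes\cdots\otimes f_n)(1\otimes\alpha\otimes v\otimes\beta\otimes1)=\begin{cases}0,&\text{if }\alpha v\neq0\text{ and }v\beta\ne0\text{ in }A;\\ A,&\text{if }\alpha v\in\mathcal R,\ v\beta\neq0\text{ in }A;\\ -B,&\text{if }\alpha v\ne0\text{ in }A,\ v\beta\in\mathcal R;\\ A-B,&\text{if }\alpha v\in\mathcal R\text{ and }v\beta\in\mathcal R,\end{cases}$$ where, in these values, $$A=(-1)^n\sum_{i=1}^n\phi_{n-1}(f_1\otimes\cdots\otimes\hat f_i\otimes\cdots\otimes f_n)(1\otimes f_i(\alpha v)\otimes\beta\otimes1),$$ $$B=(-1)^n\sum_{i=1}^n\phi_{n-1}(f_1\otimes\cdots\otimes\hat f_i\otimes\cdots\otimes f_n)(1\otimes\alpha\otimes f_i(v\beta)\otimes1),$$ and $\hat f_i$ means that $f_i$ is left out. -/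

import Mathlib

/-!
Monomial algebras, the reduced bar resolution, Bardzell's resolution, the comparison maps between
them, and the transferred `L∞`-structure on Bardzell's complex.

Everything is written in the bases given by paths.  For a monomial ideal `I` of the path algebra
`kQ`, the classes of the paths outside `I` form a basis of `A = kQ/I`.
-/

noncomputable section

namespace MonomialAlg

open Quiver Classical

/-! ### Paths -/

section Paths

variable {V : Type*} [Quiver V]

/-- A starting vertex together with a list of arrows; it is a path when `Word.IsPath` holds. -/
@[ext]
structure Word (V : Type*) [Quiver V] where
  src : V
  arrows : List (Total V)

/-- The arrows `l` can be walked along one after the other, starting from the vertex `x`. -/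
def IsWalk : V → List (Total V) → Prop
  | _, [] => True
  | x, a :: l => a.left = x ∧ IsWalk a.right l

/-- The last vertex of the walk `l` starting at `x`. -/
def walkEnd : V → List (Total V) → V
  | x, [] => x
  | _, a :: l => walkEnd a.right l

namespace Word

def IsPath (p : Word V) : Prop := IsWalk p.src p.arrows

def tgt (p : Word V) : V := walkEnd p.src p.arrows

def length (p : Word V) : ℕ := p.arrows.length

/-- The path of length zero at `x`. -/
def triv (x : V) : Word V := ⟨x, []⟩

def ofArrow (a : Total V) : Word V := ⟨a.left, [a]⟩

/-- Concatenation; meaningful when `p.tgt = q.src`. -/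
def comp (p q : Word V) : Word V := ⟨p.src, p.arrows ++ q.arrows⟩

/-- The subpath of `p` from its `i`-th to its `j`-th vertex, for `i ≤ j ≤ p.length`. -/
def sub (p : Word V) (i j : ℕ) : Word V :=
  ⟨walkEnd p.src (p.arrows.take i), (p.arrows.take j).drop i⟩

end Word

/-- The last vertex of a composable list of paths that starts at `x`. -/
def listEnd : V → List (Word V) → V
  | x, [] => x
  | _, p :: l => listEnd p.tgt l

/-- The concatenation of a composable list of paths that starts at `x`. -/
def concatAll (x : V) (l : List (Word V)) : Word V := ⟨x, l.flatMap Word.arrows⟩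

/-- `T` has an element of `R` as its subpath between the positions `i` and `j`. -/
def RelAt (R : Set (Word V)) (T : Word V) (i j : ℕ) : Prop :=
  i ≤ j ∧ j ≤ T.length ∧ T.sub i j ∈ R

/-- The path `p` lies in the ideal generated by `R`, that is, it is divisible by an element of
`R`. -/
def InIdeal (R : Set (Word V)) (p : Word V) : Prop := ∃ i j, RelAt R p i j

/-- `p` is a path whose class in `A = kQ/I` is not zero. -/
def NonzeroPath (R : Set (Word V)) (p : Word V) : Prop := p.IsPath ∧ ¬ InIdeal R p

/-- `R` is the minimal set of paths generating an admissible monomial ideal `I`: its elements are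
paths of length at least two (`I ⊆ J²`), none properly divides another, and all sufficiently long
paths are in `I` (`J^N ⊆ I`), where `J` is the ideal generated by the arrows. -/
structure IsMonomialPresentation (R : Set (Word V)) : Prop where
  isPath : ∀ r ∈ R, r.IsPath
  two_le : ∀ r ∈ R, 2 ≤ r.length
  minimal : ∀ r ∈ R, ∀ i j, RelAt R r i j → i = 0 ∧ j = r.length
  nilpotent : ∃ N : ℕ, ∀ p : Word V, p.IsPath → N ≤ p.length → InIdeal R p

/-! ### Supports of `n`-concatenations -/

/-- `i` is the smallest position with `lo ≤ i < hi` at which a relation contained in `T` starts. -/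
def FirstStart (R : Set (Word V)) (T : Word V) (lo hi i : ℕ) : Prop :=
  lo ≤ i ∧ i < hi ∧ (∃ j, RelAt R T i j) ∧
    ∀ i' j', lo ≤ i' → i' < hi → RelAt R T i' j' → i ≤ i'

/-- The relations `p_i` of `T` between positions `σ i` and `τ i`, `1 ≤ i ≤ m`, form an
`(m+1)`-concatenation `(p_1, …, p_m)` with support `T`: `p_1` starts where `T` starts, `p_m` ends
where `T` ends, `p_2` has the smallest start in the open interval `(s(p_1), t(p_1))` and `p_{i+1}`
has the smallest start in the interval `[t(p_{i-1}), t(p_i))` for `i ≥ 2`. -/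
structure IsConcatenation (R : Set (Word V)) (T : Word V) (m : ℕ) (σ τ : ℕ → ℕ) : Prop where
  start_eq : σ 1 = 0
  end_eq : τ m = T.length
  rel : ∀ i, 1 ≤ i → i ≤ m → RelAt R T (σ i) (τ i)
  second : 2 ≤ m → FirstStart R T (σ 1 + 1) (τ 1) (σ 2)
  next : ∀ i, 2 ≤ i → i + 1 ≤ m → FirstStart R T (τ (i - 1)) (τ i) (σ (i + 1))

/-- `w ∈ AP_n`: vertices for `n = 0`, arrows for `n = 1`, supports of `n`-concatenations for
`n ≥ 2`. -/
def IsAP (R : Set (Word V)) : ℕ → Word V → Prop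
  | 0, w => w.IsPath ∧ w.length = 0
  | 1, w => w.IsPath ∧ w.length = 1
  | n + 2, w => w.IsPath ∧ ∃ σ τ, IsConcatenation R w (n + 1) σ τ

/-- An element of `AP_n` divides `T`, between the positions `i` and `j`. -/
def APAt (R : Set (Word V)) (n : ℕ) (T : Word V) (i j : ℕ) : Prop :=
  i ≤ j ∧ j ≤ T.length ∧ IsAP R n (T.sub i j)

end Paths

/-! ### The algebra -/

section Algebra

variable {V : Type*} [Quiver V] (k : Type*) [Field k] (R : Set (Word V))

/-- The monomial algebra `A = kQ/I`, as the vector space on the paths that are not in `I`. -/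
abbrev Alg := {p : Word V // NonzeroPath R p} →₀ k

/-- The class in `A` of a path: zero for the paths in `I`. -/
def cls (p : Word V) : Alg k R := if h : NonzeroPath R p then Finsupp.single ⟨p, h⟩ 1 else 0

/-- The multiplication of `A`. -/
def mul (x y : Alg k R) : Alg k R :=
  Finsupp.linearCombination k (fun p : {p : Word V // NonzeroPath R p} =>
    Finsupp.linearCombination k (fun q : {q : Word V // NonzeroPath R q} =>
      if p.1.tgt = q.1.src then cls k R (p.1.comp q.1) else 0) y) x

end Algebra

/-! ### The reduced bar resolution -/

section Bar

variable {V : Type*} [Quiver V]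

/-- `l` is a composable list of paths of positive length that are not in `I`, starting at the
vertex `x`: a basis element of `(rad A)^{⊗_E n}` where `n` is the length of `l` (a basis element
`x` of `E` for `n = 0`). -/
def RadChain (R : Set (Word V)) : V → List (Word V) → Prop
  | _, [] => True
  | x, p :: l => p.src = x ∧ 1 ≤ p.length ∧ NonzeroPath R p ∧ RadChain R p.tgt l

/-- A tuple `left ⊗ mid ⊗ right`. -/
@[ext]
structure BarTuple (V : Type*) [Quiver V] where
  left : Word V
  mid : List (Word V)
  right : Word V

/-- The tuples that form a basis of `A ⊗_E (rad A)^{⊗_E n} ⊗_E A`. -/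
structure BarTuple.Valid (R : Set (Word V)) (n : ℕ) (c : BarTuple V) : Prop where
  left_nonzero : NonzeroPath R c.left
  right_nonzero : NonzeroPath R c.right
  length_mid : c.mid.length = n
  chain : RadChain R c.left.tgt c.mid
  last : listEnd c.left.tgt c.mid = c.right.src

variable (k : Type*) [Field k] (R : Set (Word V))

/-- `A ⊗_E (rad A)^{⊗_E n} ⊗_E A`. -/
abbrev Bar (n : ℕ) := {c : BarTuple V // c.Valid R n} →₀ k

/-- The element `a ⊗ l ⊗ b`; it is zero if an entry is in `I`, if consecutive entries are not
composable, or if an entry of `l` has length zero (its class in `A/E ≅ rad A` vanishes). -/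
def bar (n : ℕ) (a : Word V) (l : List (Word V)) (b : Word V) : Bar k R n :=
  if h : BarTuple.Valid R n ⟨a, l, b⟩ then Finsupp.single ⟨⟨a, l, b⟩, h⟩ 1 else 0

/-- The element `1 ⊗ l ⊗ 1`, for a list `l` of paths that starts at the vertex `x`. -/
def oneTensor (n : ℕ) (x : V) (l : List (Word V)) : Bar k R n :=
  bar k R n (Word.triv x) l (Word.triv (listEnd x l))

/-- `c ↦ p · c · q`. -/
def barAct (n : ℕ) (p q : Word V) : Bar k R n →ₗ[k] Bar k R n :=
  Finsupp.linearCombination k (fun c : {c : BarTuple V // c.Valid R n} =>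
    if p.tgt = c.1.left.src ∧ c.1.right.tgt = q.src then
      bar k R n (p.comp c.1.left) c.1.mid (c.1.right.comp q) else 0)

/-- Replaces the entries number `i` and `i + 1` (counted from `0`) by their product. -/
def mergeAt : ℕ → List (Word V) → List (Word V)
  | 0, p :: q :: l => p.comp q :: l
  | i + 1, p :: l => p :: mergeAt i l
  | _, l => l

/-- The value of the bar differential `d_{n+1}` on `a ⊗ v ⊗ l ⊗ b`, with `v` in front of the list
`l` of length `n`. -/
def barDAux (n : ℕ) (a : Word V) (l : List (Word V)) (b : Word V) : Bar k R n :=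
  match l with
  | [] => 0
  | v :: l' =>
      bar k R n (a.comp v) l' b
      + ∑ i ∈ Finset.range n, (-1 : k) ^ (i + 1) • bar k R n a (mergeAt i (v :: l')) b
      + (-1 : k) ^ (n + 1) •
          bar k R n a (v :: l').dropLast (((v :: l').getLast (by simp)).comp b)

/-- The differential `d_{n+1}` of the reduced bar resolution. -/
def barD (n : ℕ) : Bar k R (n + 1) →ₗ[k] Bar k R n :=
  Finsupp.linearCombination k (fun c : {c : BarTuple V // c.Valid R (n + 1)} =>
    barDAux k R n c.1.left c.1.mid c.1.right)

/-- The contraction `s_n (a ⊗ x) = 1 ⊗ a_r ⊗ x`, where `a_r` is the component of `a` in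
`rad A`. -/
def barS (n : ℕ) : Bar k R n →ₗ[k] Bar k R (n + 1) :=
  Finsupp.linearCombination k (fun c : {c : BarTuple V // c.Valid R n} =>
    bar k R (n + 1) (Word.triv c.1.left.src) (c.1.left :: c.1.mid) c.1.right)

end Bar

/-! ### Bardzell's resolution and the comparison maps -/

section Bardzell

variable {V : Type*} [Quiver V]

/-- A triple `left ⊗ mid ⊗ right`. -/
@[ext]
structure BzTriple (V : Type*) [Quiver V] where
  left : Word V
  mid : Word V
  right : Word V

/-- The triples that form a basis of `A ⊗_E kAP_n ⊗_E A`. -/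
structure BzTriple.Valid (R : Set (Word V)) (n : ℕ) (c : BzTriple V) : Prop where
  left_nonzero : NonzeroPath R c.left
  right_nonzero : NonzeroPath R c.right
  isAP : IsAP R n c.mid
  left_tgt : c.left.tgt = c.mid.src
  mid_tgt : c.mid.tgt = c.right.src

variable (k : Type*) [Field k] (R : Set (Word V))

/-- The bimodule `A ⊗_E kAP_n ⊗_E A` of Bardzell's resolution. -/
abbrev Bz (n : ℕ) := {c : BzTriple V // c.Valid R n} →₀ k

/-- The element `a ⊗ w ⊗ b`. -/
def bz (n : ℕ) (a w b : Word V) : Bz k R n :=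
  if h : BzTriple.Valid R n ⟨a, w, b⟩ then Finsupp.single ⟨⟨a, w, b⟩, h⟩ 1 else 0

/-- `c ↦ p · c · q`. -/
def bzAct (n : ℕ) (p q : Word V) : Bz k R n →ₗ[k] Bz k R n :=
  Finsupp.linearCombination k (fun c : {c : BzTriple V // c.Valid R n} =>
    if p.tgt = c.1.left.src ∧ c.1.right.tgt = q.src then
      bz k R n (p.comp c.1.left) c.1.mid (c.1.right.comp q) else 0)

/-- `F_n (1 ⊗ w ⊗ 1)` for `w ∈ AP_n`.  It is the sum of `1 ⊗ L(ψ) F_{n-1}(1 ⊗ ψ ⊗ 1) R(ψ)` over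
the `ψ ∈ AP_{n-1}` that divide `w = L(ψ) ψ R(ψ)`; when `n` is odd only the `ψ` with
`w = L(ψ) ψ` is taken. -/
def compFAux : (n : ℕ) → Word V → Bar k R n
  | 0, w => oneTensor k R 0 w.src []
  | 1, w => oneTensor k R 1 w.src [w]
  | n + 2, w =>
      ∑ i ∈ Finset.range (w.length + 1), ∑ j ∈ Finset.range (w.length + 1),
        if APAt R (n + 1) w i j ∧ (Odd (n + 2) → j = w.length) then
          barS k R (n + 1) (barAct k R (n + 1) (w.sub 0 i) (w.sub j w.length)
            (compFAux (n + 1) (w.sub i j)))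
        else 0

/-- The comparison map `F_n : A ⊗ kAP_n ⊗ A → A ⊗ (rad A)^{⊗ n} ⊗ A`. -/
def compF (n : ℕ) : Bz k R n →ₗ[k] Bar k R n :=
  Finsupp.linearCombination k (fun c : {c : BzTriple V // c.Valid R n} =>
    barAct k R n c.1.left c.1.right (compFAux k R n c.1.mid))

/-- For `l = [v_1, v_2, v_3, v_4, …]`: the products `v_1 v_2`, `v_3 v_4`, … are in `I`. -/
def PairsInIdeal (R : Set (Word V)) : List (Word V) → Prop
  | p :: q :: l => InIdeal R (p.comp q) ∧ PairsInIdeal R l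
  | _ => True

/-- The length of the first entry. -/
def firstLength : List (Word V) → ℕ
  | [] => 0
  | p :: _ => p.length

/-- `G_n (1 ⊗ v_1 ⊗ ⋯ ⊗ v_n ⊗ 1)` for `l = [v_1, …, v_n]` starting at the vertex `x`.
For `n` even it is `L ⊗ w ⊗ R` with `w ∈ AP_n` the divisor of `v_1 ⋯ v_n = L w R` with the smallest
start, if all `v_{2i-1} v_{2i}` are in `I` (and such a `w` exists), and zero otherwise.
For `n` odd it is the sum of all `L ⊗ w ⊗ R` with `w ∈ AP_n`, `v_1 ⋯ v_n = L w R` and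
`s(w) < t(v_1)`, if all `v_{2i} v_{2i+1}` are in `I`, and zero otherwise. -/
def compGAux (n : ℕ) (x : V) (l : List (Word V)) : Bz k R n :=
  let T := concatAll x l
  if PairsInIdeal R (if Even n then l else l.tail) then
    ∑ i ∈ Finset.range (T.length + 1), ∑ j ∈ Finset.range (T.length + 1),
      if APAt R n T i j ∧
          (if Even n then ∀ i' j', APAt R n T i' j' → i ≤ i' else i < firstLength l) then
        bz k R n (T.sub 0 i) (T.sub i j) (T.sub j T.length)
      else 0
  else 0

/-- The comparison map `G_n : A ⊗ (rad A)^{⊗ n} ⊗ A → A ⊗ kAP_n ⊗ A`. -/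
def compG (n : ℕ) : Bar k R n →ₗ[k] Bz k R n :=
  Finsupp.linearCombination k (fun c : {c : BarTuple V // c.Valid R n} =>
    bzAct k R n c.1.left c.1.right (compGAux k R n c.1.left.tgt c.1.mid))

/-- The homotopy `H_n`: the `A`-linear maps with `H_0 = 0` and
`H_n (1 ⊗ x) = (s_n F_n G_n - s_n H_{n-1} d_n) (1 ⊗ x)`. -/
def homotopy : (n : ℕ) → Bar k R n →ₗ[k] Bar k R (n + 1)
  | 0 => 0
  | n + 1 =>
      Finsupp.linearCombination k (fun c : {c : BarTuple V // c.Valid R (n + 1)} =>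
        let y := bar k R (n + 1) (Word.triv c.1.left.tgt) c.1.mid c.1.right
        barAct k R (n + 2) c.1.left (Word.triv c.1.right.tgt)
          (barS k R (n + 1) (compF k R (n + 1) (compG k R (n + 1) y))
            - barS k R (n + 1) (homotopy n (barD k R n y))))

end Bardzell

/-! ### Cochains -/

section Cochains

variable {V : Type*} [Quiver V] (k : Type*) [Field k] (R : Set (Word V))

/-- Linear maps `(rad A)^{⊗_E n} → A`, given by their values on the basis. -/
abbrev HochCochain (n : ℕ) :=
  {c : V × List (Word V) // c.2.length = n ∧ RadChain R c.1 c.2} → Alg k R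

/-- Linear maps `kAP_n → A`. -/
abbrev BzCochain (n : ℕ) := {w : Word V // IsAP R n w} → Alg k R

/-- `B^n(A) = Hom_{E-E}(kAP_n, A)`: the linear maps sending each `w ∈ AP_n` to a combination of
paths parallel to `w`. -/
def bardzellCochains (n : ℕ) : Submodule k (BzCochain k R n) where
  carrier := {f | ∀ w, ∀ p ∈ (f w).support, p.1.src = w.1.src ∧ p.1.tgt = w.1.tgt}
  zero_mem' := by
    intro w p hp
    simp at hp
  add_mem' := by
    intro f g hf hg w p hp
    have h := Finsupp.support_add hp
    rcases Finset.mem_union.1 h with h | h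
    · exact hf w p h
    · exact hg w p h
  smul_mem' := by
    intro c f hf w p hp
    exact hf w p (Finsupp.support_smul hp)

/-- Families of cochains, one in each arity.  A cochain of arity `n` is a family that vanishes in
all other arities. -/
abbrev HochTotal := (N : ℕ) → HochCochain k R N

/-- A homogeneous element of Bardzell's complex: an arity `n` and an element of arity `n`.  Its
degree in the shifted complex is `n - 1`. -/
abbrev BzElt := (n : ℕ) × BzCochain k R n

variable {k R}

/-- The value of a cochain on the tensor `l` starting at `x`; it is zero on the lists that
represent the zero tensor. -/
def HochCochain.ev {n : ℕ} (f : HochCochain k R n) (x : V) (l : List (Word V)) : Alg k R :=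
  if h : l.length = n ∧ RadChain R x l then f ⟨(x, l), h⟩ else 0

/-- The bimodule extension `f̂ (a ⊗ v_1 ⊗ ⋯ ⊗ v_n ⊗ b) = a f(v_1 ⊗ ⋯ ⊗ v_n) b`. -/
def HochCochain.hat {n : ℕ} (f : HochCochain k R n) : Bar k R n →ₗ[k] Alg k R :=
  Finsupp.linearCombination k (fun c : {c : BarTuple V // c.Valid R n} =>
    mul k R (cls k R c.1.left) (mul k R (f.ev c.1.left.tgt c.1.mid) (cls k R c.1.right)))

/-- The value of `f` on `w`, zero if `w` is not in `AP_n`. -/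
def BzCochain.ev {n : ℕ} (f : BzCochain k R n) (w : Word V) : Alg k R :=
  if h : IsAP R n w then f ⟨w, h⟩ else 0

/-- The bimodule extension `f̂ (a ⊗ w ⊗ b) = a f(w) b`. -/
def BzCochain.hat {n : ℕ} (f : BzCochain k R n) : Bz k R n →ₗ[k] Alg k R :=
  Finsupp.linearCombination k (fun c : {c : BzTriple V // c.Valid R n} =>
    mul k R (cls k R c.1.left) (mul k R (f.ev c.1.mid) (cls k R c.1.right)))

/-- `F^n (f) = f F_n`. -/
def starF (f : HochTotal k R) (n : ℕ) : BzCochain k R n :=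
  fun w => (f n).hat (compFAux k R n w.1)

/-- `G^n (f) = f G_n`. -/
def starG (f : BzElt k R) : HochTotal k R :=
  fun N c =>
    if h : f.1 = N then (h ▸ f.2 : BzCochain k R N).hat
      (compG k R N (oneTensor k R N c.1.1 c.1.2))
    else 0

/-- `(-1)^{n-1} H^n (f) = f H_{n-1}`. -/
def starH (f : HochTotal k R) : HochTotal k R :=
  fun N c => (-1 : k) ^ N • (f (N + 1)).hat
    (homotopy k R N (oneTensor k R N c.1.1 c.1.2))

/-- The Gerstenhaber product
`f ∘ g = ∑_{i=0}^{n-1} (-1)^{i(m+1)} f (Id^{⊗ i} ⊗ g ⊗ Id^{⊗ n-i-1})` of cochains of arities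
`n` and `m`, of arity `n + m - 1`. -/
def gerstProd {n m : ℕ} (f : HochCochain k R n) (g : HochCochain k R m) :
    HochTotal k R :=
  fun N c =>
    if N + 1 = n + m then
      ∑ i ∈ Finset.range n, (-1 : k) ^ (i * (m + 1)) •
        Finsupp.linearCombination k
          (fun p : {p : Word V // NonzeroPath R p} =>
            f.ev c.1.1 (c.1.2.take i ++ p.1 :: c.1.2.drop (i + m)))
          (g.ev (listEnd c.1.1 (c.1.2.take i)) ((c.1.2.drop i).take m))
    else 0

/-- `(-1)^z`. -/
def sign (z : ℤ) : ℤ := (z.negOnePow : ℤ)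

/-- The Gerstenhaber bracket `[f, g] = f ∘ g - (-1)^{(n-1)(m-1)} g ∘ f`. -/
def gerstBracket {n m : ℕ} (f : HochCochain k R n) (g : HochCochain k R m) :
    HochTotal k R :=
  gerstProd f g - sign (((n : ℤ) - 1) * ((m : ℤ) - 1)) • gerstProd g f

end Cochains

/-! ### Transferred structure -/

section Transfer

variable {V : Type*} [Quiver V] {k : Type*} [Field k] {R : Set (Word V)}

/-- The degree in the shifted complex. -/
def BzElt.deg (f : BzElt k R) : ℤ := (f.1 : ℤ) - 1

/-- The arity of `φ_n (f_1, …, f_n)`, whose shifted degree is `∑ |f_i| + 1 - n`. -/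
def arityPhi {n : ℕ} (f : Fin n → BzElt k R) : ℕ := (∑ i, BzElt.deg (f i) + 1 - n + 1).toNat

/-- The arity of `l_n (f_1, …, f_n)`, whose shifted degree is `∑ |f_i| + 2 - n`. -/
def arityL {n : ℕ} (f : Fin n → BzElt k R) : ℕ := (∑ i, BzElt.deg (f i) + 2 - n + 1).toNat

/-- The `(t, n-t)`-unshuffles. -/
def unshuffles (n t : ℕ) : Finset (Equiv.Perm (Fin n)) :=
  Finset.univ.filter fun σ =>
    (∀ i j : Fin n, i < j → j.1 < t → σ i < σ j) ∧
    (∀ i j : Fin n, i < j → t ≤ i.1 → σ i < σ j)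

/-- The `(t, n-t)`-unshuffles with `σ(1) < σ(t+1)`. -/
def unshufflesMinus (n t : ℕ) : Finset (Equiv.Perm (Fin n)) :=
  (unshuffles n t).filter fun σ => ∀ i j : Fin n, i.1 = 0 → j.1 = t → σ i < σ j

/-- The Koszul sign `ε(σ)`: `f_1 ∧ ⋯ ∧ f_n = ε(σ) f_{σ(1)} ∧ ⋯ ∧ f_{σ(n)}`. -/
def koszul {n : ℕ} (σ : Equiv.Perm (Fin n)) (f : Fin n → BzElt k R) : ℤ :=
  ∏ p ∈ Finset.univ.filter (fun p : Fin n × Fin n => p.1 < p.2 ∧ σ p.2 < σ p.1),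
    sign (BzElt.deg (f (σ p.1)) * BzElt.deg (f (σ p.2)))

/-- The antisymmetric Koszul sign `χ(σ) = sgn(σ) ε(σ)`. -/
def chi {n : ℕ} (σ : Equiv.Perm (Fin n)) (f : Fin n → BzElt k R) : ℤ :=
  (Equiv.Perm.sign σ : ℤ) * koszul σ f

/-- `κ(σ)_t = (-1)^{(t-1) + (n-t-1) ∑_{p ≤ t} |f_{σ(p)}|}`. -/
def kappa {n : ℕ} (σ : Equiv.Perm (Fin n)) (t : ℕ) (f : Fin n → BzElt k R) : ℤ :=
  sign (((t : ℤ) - 1) + ((n : ℤ) - t - 1) *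
    ∑ p ∈ Finset.univ.filter (fun p : Fin n => p.1 < t), BzElt.deg (f (σ p)))

/-- `(f_{σ(1)}, …, f_{σ(t)})`. -/
def firstPart {n : ℕ} (σ : Equiv.Perm (Fin n)) (t : ℕ) (ht : t ≤ n) (f : Fin n → BzElt k R) :
    Fin t → BzElt k R :=
  fun i => f (σ ⟨i.1, by omega⟩)

/-- `(f_{σ(t+1)}, …, f_{σ(n)})`. -/
def lastPart {n : ℕ} (σ : Equiv.Perm (Fin n)) (t : ℕ) (f : Fin n → BzElt k R) :
    Fin (n - t) → BzElt k R :=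
  fun i => f (σ ⟨t + i.1, by omega⟩)

mutual

/-- `v_n = ∑_{t=1}^{n-1} ∑_{τ ∈ S⁻_{t,n-t}} χ(τ) κ(τ)_t [φ_t, φ_{n-t}] τ̂`, so that `v_1 = 0`. -/
def vMap (n : ℕ) (f : Fin n → BzElt k R) : HochTotal k R :=
  ∑ t : Fin n, if _h : 1 ≤ t.1 then
    ∑ τ ∈ unshufflesMinus n t.1, (chi τ f * kappa τ t.1 f) •
      gerstBracket
        (phiMap t.1 (firstPart τ t.1 t.2.le f) (arityPhi (firstPart τ t.1 t.2.le f)))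
        (phiMap (n - t.1) (lastPart τ t.1 f) (arityPhi (lastPart τ t.1 f)))
  else 0
termination_by (n, 0)

/-- `l_n = F^* v_n`, for `n ≥ 2`.  (The map `l_1`, which is the differential of Bardzell's complex,
does not enter the recursion.) -/
def lMap (n : ℕ) (f : Fin n → BzElt k R) : BzElt k R :=
  ⟨arityL f, starF (vMap n f) (arityL f)⟩
termination_by (n, 1)

/-- `u_n = ∑_{k=2}^n ∑_{τ ∈ S_{k,n-k}} (-1)^{k(n-k)+1} χ(τ) φ_{n-k+1} (l_k ⊗ Id^{⊗ n-k}) τ̂`, so that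
`u_1 = 0`. -/
def uMap (n : ℕ) (f : Fin n → BzElt k R) : HochTotal k R :=
  ∑ j : Fin (n + 1), if _h : 2 ≤ j.1 then
    ∑ τ ∈ unshuffles n j.1, (sign ((j.1 : ℤ) * ((n : ℤ) - j.1) + 1) * chi τ f) •
      phiMap (n - j.1 + 1)
        (Fin.cons (α := fun _ => BzElt k R)
          (lMap j.1 (firstPart τ j.1 (Nat.le_of_lt_succ j.2) f)) (lastPart τ j.1 f))
  else 0
termination_by (n, 2)
decreasing_by
  all_goals
    rw [Prod.lex_def]
    simp only
    omega

/-- `φ_1 = G^*` and `φ_n = H^* (u_n + v_n)` for `n ≥ 2`. -/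
def phiMap (n : ℕ) (f : Fin n → BzElt k R) : HochTotal k R :=
  match n, f with
  | 0, _ => 0
  | 1, f => starG (f 0)
  | n + 2, f => starH (uMap (n + 2) f + vMap (n + 2) f)
termination_by (n, 3)

end

/-- An element of `B^1(A)[1] = Hom_{E-E}(kAP_2, A)` as a homogeneous element. -/
def ofDegreeOne (f : bardzellCochains k R 2) : BzElt k R := ⟨2, f.1⟩

/-- `φ_{n-1} (f_1 ⊗ ⋯ ⊗ f̂_i ⊗ ⋯ ⊗ f_n)`, where `n = m + 1` and `f_i` is left out. -/
def phiOmit {m : ℕ} (f : Fin (m + 1) → bardzellCochains k R 2) (i : Fin (m + 1)) :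
    HochCochain k R 2 :=
  phiMap m (fun j => ofDegreeOne (f (i.succAbove j))) 2

/-- `1 ⊗ x ⊗ b ⊗ 1`, linear in `x ∈ A`. -/
def tensorLeft (x : Alg k R) (b : Word V) : Bar k R 2 :=
  Finsupp.linearCombination k
    (fun p : {p : Word V // NonzeroPath R p} => oneTensor k R 2 p.1.src [p.1, b]) x

/-- `1 ⊗ a ⊗ x ⊗ 1`, linear in `x ∈ A`. -/
def tensorRight (a : Word V) (x : Alg k R) : Bar k R 2 :=
  Finsupp.linearCombination k
    (fun p : {p : Word V // NonzeroPath R p} => oneTensor k R 2 a.src [a, p.1]) x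

/-- `(-1)^n ∑_i φ_{n-1} (f_1 ⊗ ⋯ ⊗ f̂_i ⊗ ⋯ ⊗ f_n) (1 ⊗ f_i(αv) ⊗ β ⊗ 1)`, with `n = m + 1`. -/
def termA {m : ℕ} (f : Fin (m + 1) → bardzellCochains k R 2) (α : Total V) (v : Word V)
    (β : Total V) : Alg k R :=
  (-1 : k) ^ (m + 1) • ∑ i, (phiOmit f i).hat
    (tensorLeft (BzCochain.ev (f i).1 ((Word.ofArrow α).comp v)) (Word.ofArrow β))

/-- `(-1)^n ∑_i φ_{n-1} (f_1 ⊗ ⋯ ⊗ f̂_i ⊗ ⋯ ⊗ f_n) (1 ⊗ α ⊗ f_i(vβ) ⊗ 1)`, with `n = m + 1`. -/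
def termB {m : ℕ} (f : Fin (m + 1) → bardzellCochains k R 2) (α : Total V) (v : Word V)
    (β : Total V) : Alg k R :=
  (-1 : k) ^ (m + 1) • ∑ i, (phiOmit f i).hat
    (tensorRight (Word.ofArrow α) (BzCochain.ev (f i).1 (v.comp (Word.ofArrow β))))

/-- `v_n (f_1 ⊗ ⋯ ⊗ f_n) (1 ⊗ α ⊗ v ⊗ β ⊗ 1)`. -/
def vValue {n : ℕ} (f : Fin n → bardzellCochains k R 2) (α : Total V) (v : Word V)
    (β : Total V) : Alg k R :=
  (vMap n (fun i => ofDegreeOne (f i)) 3).hat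
    (oneTensor k R 3 α.left [Word.ofArrow α, v, Word.ofArrow β])

/-- The product of the paths `p` and `q` is not zero in `A`. -/
def ProdNeZero (k : Type*) [Field k] (R : Set (Word V)) (p q : Word V) : Prop :=
  mul k R (cls k R p) (cls k R q) ≠ 0

end Transfer

end MonomialAlg

end

-- All four cases are instances of one formula, v_n = A - B on 1 ⊗ α ⊗ v ⊗ β ⊗ 1, valid whenever αv
-- and vβ are tame, that is, nonzero in A or generating relations. If αv is nonzero in A, it is not
-- in AP_2, so every f_i vanishes on it and A = 0; likewise B = 0 if vβ is nonzero.
--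
-- The formula rests on one vanishing statement (`phiMap_two_ev`): for n ≥ 2 and arguments of arity
-- two, φ_n is zero on u ⊗ v whenever uv is tame. Granting it, a bracket [φ_t, φ_{n-t}] with 2 ≤ t ≤
-- n-2 contributes nothing, because its inner factors are evaluated on αv and vβ only. For t = 1 and
-- t = n-1 only φ_{n-1} ∘ φ_1 survives, and φ_1(f) takes a tame pair to the value of f on the
-- product. The unshuffles for t = 1 and t = n-1 together leave out each f_i exactly once, always
-- with sign (-1)^n.
--
-- For the vanishing, one computes H_2(1 ⊗ u ⊗ v ⊗ 1). The contraction s kills tensors whose left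
-- factor is a vertex. This removes s F_2 G_2 and every term of s H_1 d_2 except the one coming from
-- u ⊗ v ⊗ 1, so H_2 is supported on 1 ⊗ u ⊗ L ⊗ e ⊗ R with e an arrow and v = L e R. Tameness makes
-- uL and Le nonzero in A. On such triples u_n vanishes, since both G_3 and H_3 do
-- (`uMap_three_ev`), and v_n vanishes by induction on n, since its inner factors see only the
-- nonzero products uL and Le (`vMap_three_ev`).

noncomputable section

namespace MonomialAlg

open Quiver Classical

-- Walks, divisors and tame paths

section Words

variable {V : Type*} [Quiver V]

lemma isWalk_append (x : V) (l l' : List (Total V)) :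
    IsWalk x (l ++ l') ↔ IsWalk x l ∧ IsWalk (walkEnd x l) l' := by
  induction l generalizing x with
  | nil => simp [IsWalk, walkEnd]
  | cons a l ih => simp [IsWalk, walkEnd, ih, and_assoc]

lemma walkEnd_append (x : V) (l l' : List (Total V)) :
    walkEnd x (l ++ l') = walkEnd (walkEnd x l) l' := by
  induction l generalizing x with
  | nil => simp [walkEnd]
  | cons a l ih => simp [walkEnd, ih]

variable {R : Set (Word V)}

lemma RelAt.append_right {x : V} {l : List (Total V)} {i j : ℕ} (h : RelAt R ⟨x, l⟩ i j)
    (l' : List (Total V)) : RelAt R ⟨x, l ++ l'⟩ i j := by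
  obtain ⟨hij, hj, hmem⟩ := h
  simp only [Word.length] at hj
  refine ⟨hij, by simp [Word.length]; omega, ?_⟩
  simp only [Word.sub] at hmem ⊢
  rwa [List.take_append_of_le_length hj, List.take_append_of_le_length (hij.trans hj)]

lemma RelAt.append_left {x : V} {l : List (Total V)} {i j : ℕ} (l₀ : List (Total V))
    (h : RelAt R ⟨walkEnd x l₀, l⟩ i j) :
    RelAt R ⟨x, l₀ ++ l⟩ (l₀.length + i) (l₀.length + j) := by
  obtain ⟨hij, hj, hmem⟩ := h
  simp only [Word.length] at hj
  refine ⟨by omega, by simp [Word.length]; omega, ?_⟩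
  simp only [Word.sub] at hmem ⊢
  rw [List.take_length_add_append, List.take_length_add_append, walkEnd_append]
  rw [List.drop_append, List.drop_eq_nil_of_le (Nat.le_add_right _ _)]
  simpa using hmem

lemma Word.sub_self_length (p : Word V) : p.sub 0 p.length = p := by
  ext1
  · simp [Word.sub, walkEnd]
  · simp [Word.sub, Word.length]

lemma relAt_of_mem {p : Word V} (h : p ∈ R) : RelAt R p 0 p.length :=
  ⟨Nat.zero_le _, le_rfl, by rwa [Word.sub_self_length]⟩

/-- A 2-concatenation consists of a single relation, which starts and ends with its support. -/
lemma isAP_two_iff {w : Word V} (hw : w.IsPath) : IsAP R 2 w ↔ w ∈ R := by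
  constructor
  · rintro ⟨-, σ, τ, h⟩
    have h1 := h.rel 1 le_rfl le_rfl
    rw [h.start_eq, show τ 1 = w.length from h.end_eq] at h1
    simpa [Word.sub_self_length] using h1.2.2
  · intro h
    refine ⟨hw, fun _ => 0, fun _ => w.length, rfl, rfl, ?_, ?_, ?_⟩
    · intro i _ _
      exact relAt_of_mem h
    · intro h2
      exact absurd h2 (by decide)
    · intro i h1 h2
      have h3 : i + 1 ≤ 1 := h2
      omega

lemma IsMonomialPresentation.not_inIdeal_of_length_le_one (hR : IsMonomialPresentation R)
    {p : Word V} (hp : p.length ≤ 1) : ¬ InIdeal R p := by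
  rintro ⟨i, j, hij, hj, hmem⟩
  have := hR.two_le _ hmem
  simp only [Word.sub, Word.length, List.length_drop, List.length_take] at this hj hp
  omega

lemma IsMonomialPresentation.nonzeroPath_triv (hR : IsMonomialPresentation R) (x : V) :
    NonzeroPath R (Word.triv x) :=
  ⟨trivial, hR.not_inIdeal_of_length_le_one (by simp [Word.triv, Word.length])⟩

lemma IsMonomialPresentation.nonzeroPath_ofArrow (hR : IsMonomialPresentation R) (a : Total V) :
    NonzeroPath R (Word.ofArrow a) :=
  ⟨by simp [Word.ofArrow, Word.IsPath, IsWalk],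
    hR.not_inIdeal_of_length_le_one (by simp [Word.ofArrow, Word.length])⟩

/-- A path that is either nonzero in `A` or one of the generating relations; equivalently, none
of its proper divisors lies in the ideal. -/
def Tame (R : Set (Word V)) (w : Word V) : Prop := w.IsPath ∧ (¬ InIdeal R w ∨ w ∈ R)

lemma Tame.of_nonzeroPath {w : Word V} (h : NonzeroPath R w) : Tame R w := ⟨h.1, Or.inl h.2⟩

lemma Tame.of_mem (hR : IsMonomialPresentation R) {w : Word V} (h : w ∈ R) : Tame R w :=
  ⟨hR.isPath w h, Or.inr h⟩

/-- Relations in a tame path fill it up. -/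
lemma Tame.relAt_eq (hR : IsMonomialPresentation R) {w : Word V} (h : Tame R w) {i j : ℕ}
    (hij : RelAt R w i j) : i = 0 ∧ j = w.length := by
  rcases h.2 with h | h
  · exact absurd ⟨i, j, hij⟩ h
  · exact hR.minimal w h i j hij

/-- A relation inside a proper prefix would not reach the end of the whole path, contrary to
minimality. -/
lemma Tame.not_inIdeal_prefix (hR : IsMonomialPresentation R) {x : V} {l l' : List (Total V)}
    (h : Tame R ⟨x, l ++ l'⟩) (hl' : l' ≠ []) : ¬ InIdeal R ⟨x, l⟩ := by
  rintro ⟨i, j, hij⟩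
  have h1 := (h.relAt_eq hR (hij.append_right l')).2
  have h2 := hij.2.1
  have := List.length_pos_iff.2 hl'
  simp [Word.length] at h1 h2
  omega

lemma Tame.not_inIdeal_suffix (hR : IsMonomialPresentation R) {x : V} {l l' : List (Total V)}
    (h : Tame R ⟨x, l ++ l'⟩) (hl : l ≠ []) : ¬ InIdeal R ⟨walkEnd x l, l'⟩ := by
  rintro ⟨i, j, hij⟩
  have h1 := (h.relAt_eq hR (hij.append_left l)).1
  have := List.length_pos_iff.2 hl
  omega

end Words

-- Supports in the bar and Bardzell bases; what the contraction kills

section Supports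

variable {V : Type*} [Quiver V] {k : Type*} [Field k] {R : Set (Word V)}

/-- The vectors supported on the basis elements with the property `P`. -/
abbrev suppOn (k : Type*) [Field k] {ι : Type*} {Q : ι → Prop} (P : ι → Prop) :
    Submodule k ({c // Q c} →₀ k) :=
  Finsupp.supported k k {c | P c.1}

/-- The comparison maps are defined on bases, so support conditions pass through them one basis
element at a time. This replaces explicit computation of F, G and H below. -/
lemma linearCombination_mem_of_suppOn {ι M : Type*} [AddCommGroup M] [Module k M] {Q : ι → Prop}
    {P : ι → Prop} {S : Submodule k M} {g : {c // Q c} → M} {x : {c // Q c} →₀ k}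
    (hx : x ∈ suppOn k P) (hg : ∀ c, P c.1 → g c ∈ S) :
    Finsupp.linearCombination k g x ∈ S := by
  rw [Finsupp.linearCombination_apply]
  exact Submodule.sum_mem _ fun c hc => S.smul_mem _ (hg c ((Finsupp.mem_supported _ _).1 hx hc))

lemma suppOn_true {ι : Type*} {Q : ι → Prop} (x : {c // Q c} →₀ k) :
    x ∈ suppOn k (fun _ => True) :=
  (Finsupp.mem_supported _ _).2 fun _ _ => trivial

lemma bar_mem {n : ℕ} {P : BarTuple V → Prop} {a b : Word V} {l : List (Word V)}
    (h : BarTuple.Valid R n ⟨a, l, b⟩ → P ⟨a, l, b⟩) : bar k R n a l b ∈ suppOn k P := by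
  unfold bar
  split_ifs with hv
  · exact Finsupp.single_mem_supported _ _ (h hv)
  · exact Submodule.zero_mem _

lemma bz_mem {n : ℕ} {P : BzTriple V → Prop} {a w b : Word V}
    (h : BzTriple.Valid R n ⟨a, w, b⟩ → P ⟨a, w, b⟩) : bz k R n a w b ∈ suppOn k P := by
  unfold bz
  split_ifs with hv
  · exact Finsupp.single_mem_supported _ _ (h hv)
  · exact Submodule.zero_mem _

lemma barAct_mem {n : ℕ} {P P' : BarTuple V → Prop} {p q : Word V} {x : Bar k R n}
    (hx : x ∈ suppOn k P)
    (h : ∀ c : BarTuple V, P c → P' ⟨p.comp c.left, c.mid, c.right.comp q⟩) :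
    barAct k R n p q x ∈ suppOn k P' := by
  refine linearCombination_mem_of_suppOn hx fun c hc => ?_
  split_ifs
  · exact bar_mem fun _ => h _ hc
  · exact Submodule.zero_mem _

lemma bzAct_mem {n : ℕ} {P P' : BzTriple V → Prop} {p q : Word V} {x : Bz k R n}
    (hx : x ∈ suppOn k P)
    (h : ∀ c : BzTriple V, P c → P' ⟨p.comp c.left, c.mid, c.right.comp q⟩) :
    bzAct k R n p q x ∈ suppOn k P' := by
  refine linearCombination_mem_of_suppOn hx fun c hc => ?_
  split_ifs
  · exact bz_mem fun _ => h _ hc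
  · exact Submodule.zero_mem _

lemma barS_mem {n : ℕ} {P P' : BarTuple V → Prop} {x : Bar k R n} (hx : x ∈ suppOn k P)
    (h : ∀ c : BarTuple V, P c → 1 ≤ c.left.length →
      P' ⟨Word.triv c.left.src, c.left :: c.mid, c.right⟩) :
    barS k R n x ∈ suppOn k P' := by
  refine linearCombination_mem_of_suppOn hx fun c hc => ?_
  exact bar_mem fun hv => h _ hc hv.chain.2.1

/-- The left factor is a vertex. -/
def BarTuple.LeftTrivial (c : BarTuple V) : Prop := c.left.length = 0

/-- The left factor is a vertex. -/
def BzTriple.LeftTrivial (c : BzTriple V) : Prop := c.left.length = 0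

lemma barS_leftTrivial {n : ℕ} (x : Bar k R n) : barS k R n x ∈ suppOn k BarTuple.LeftTrivial :=
  barS_mem (suppOn_true x) fun _ _ _ => rfl

/-- A vertex has no component in rad A. Together with `barS_leftTrivial` this contains s² = 0, and
it is the source of all cancellations in H. -/
lemma barS_eq_zero {n : ℕ} {x : Bar k R n} (hx : x ∈ suppOn k BarTuple.LeftTrivial) :
    barS k R n x = 0 := by
  rw [← Submodule.mem_bot k]
  refine linearCombination_mem_of_suppOn hx fun c hc => ?_
  rw [Submodule.mem_bot]
  refine dif_neg fun hv => ?_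
  have h1 := hv.chain.2.1
  simp only [BarTuple.LeftTrivial] at hc
  omega

lemma barAct_leftTrivial {n : ℕ} {p q : Word V} (hp : p.length = 0) {x : Bar k R n}
    (hx : x ∈ suppOn k BarTuple.LeftTrivial) :
    barAct k R n p q x ∈ suppOn k BarTuple.LeftTrivial :=
  barAct_mem hx fun c hc => by
    simp only [BarTuple.LeftTrivial, Word.length, Word.comp, List.length_append] at hc hp ⊢
    omega

lemma homotopy_leftTrivial {n : ℕ} {x : Bar k R n} (hx : x ∈ suppOn k BarTuple.LeftTrivial) :
    homotopy k R n x ∈ suppOn k BarTuple.LeftTrivial := by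
  cases n with
  | zero => simp [homotopy]
  | succ n =>
    rw [homotopy]
    refine linearCombination_mem_of_suppOn hx fun c hc => ?_
    exact barAct_leftTrivial hc (Submodule.sub_mem _ (barS_leftTrivial _) (barS_leftTrivial _))

lemma compFAux_leftTrivial (n : ℕ) (w : Word V) :
    compFAux k R n w ∈ suppOn k BarTuple.LeftTrivial := by
  match n with
  | 0 => exact bar_mem fun _ => rfl
  | 1 => exact bar_mem fun _ => rfl
  | n + 2 =>
    rw [compFAux]
    refine Submodule.sum_mem _ fun i _ => Submodule.sum_mem _ fun j _ => ?_
    split_ifs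
    · exact barS_leftTrivial _
    · exact Submodule.zero_mem _

lemma compF_leftTrivial {n : ℕ} {x : Bz k R n} (hx : x ∈ suppOn k BzTriple.LeftTrivial) :
    compF k R n x ∈ suppOn k BarTuple.LeftTrivial :=
  linearCombination_mem_of_suppOn hx fun _ hc => barAct_leftTrivial hc (compFAux_leftTrivial _ _)

lemma compF_one_mem {P : BzTriple V → Prop} {P' : BarTuple V → Prop} {x : Bz k R 1}
    (hx : x ∈ suppOn k P)
    (h : ∀ c : BzTriple V, P c → P' ⟨c.left.comp (Word.triv c.mid.src), [c.mid],
      (Word.triv c.mid.tgt).comp c.right⟩) :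
    compF k R 1 x ∈ suppOn k P' := by
  refine linearCombination_mem_of_suppOn hx fun c hc => ?_
  refine barAct_mem (P := fun d => d = ⟨Word.triv c.1.mid.src, [c.1.mid], Word.triv c.1.mid.tgt⟩)
    (bar_mem fun _ => rfl) ?_
  rintro d rfl
  exact h _ hc

/-- Only the first face of the bar differential changes the left factor. -/
lemma barD_single_sub_mem {n : ℕ} {a v b : Word V} {l : List (Word V)}
    (h : BarTuple.Valid R (n + 1) ⟨a, v :: l, b⟩) (ha : a.length = 0) :
    barD k R n (Finsupp.single ⟨⟨a, v :: l, b⟩, h⟩ 1) - bar k R n (a.comp v) l b ∈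
      suppOn k BarTuple.LeftTrivial := by
  rw [barD, Finsupp.linearCombination_single, one_smul, barDAux, add_assoc, add_sub_cancel_left]
  refine Submodule.add_mem _ (Submodule.sum_mem _ fun i _ => ?_) ?_
  · exact Submodule.smul_mem _ _ (bar_mem fun _ => ha)
  · exact Submodule.smul_mem _ _ (bar_mem fun _ => ha)

/-- Of the terms of `d (1 ⊗ v ⊗ l ⊗ b)` only the first one contributes to `s H d`. -/
lemma barS_homotopy_barD {n : ℕ} {a v b : Word V} {l : List (Word V)}
    (h : BarTuple.Valid R (n + 1) ⟨a, v :: l, b⟩) (ha : a.length = 0) :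
    barS k R (n + 1) (homotopy k R n (barD k R n (Finsupp.single ⟨⟨a, v :: l, b⟩, h⟩ 1))) =
      barS k R (n + 1) (homotopy k R n (bar k R n (a.comp v) l b)) := by
  rw [← sub_eq_zero, ← map_sub, ← map_sub]
  exact barS_eq_zero (homotopy_leftTrivial (barD_single_sub_mem h ha))

end Supports

-- The homotopies H_1, H_2, H_3 on tame tensors

section Homotopy

variable {V : Type*} [Quiver V] {k : Type*} [Field k] {R : Set (Word V)}

lemma compG_eq_zero {n : ℕ} {l : List (Word V)} {b : Word V} {a : Word V}
    (h : ¬ PairsInIdeal R (if Even n then l else l.tail)) :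
    compG k R n (bar k R n a l b) = 0 := by
  unfold bar
  split_ifs with hv
  · rw [compG, Finsupp.linearCombination_single, one_smul]
    simp only [compGAux, if_neg h, map_zero]
  · exact map_zero _

/-- `L ⊗ a ⊗ R` with `a` an arrow and `v = L a R`. -/
def BzTriple.SplitsAtArrow (l : List (Total V)) (c : BzTriple V) : Prop :=
  c.mid.length = 1 ∧ c.left.arrows ++ c.mid.arrows ++ c.right.arrows = l

lemma compG_one_mem (a v b : Word V) (ha : a.length = 0) (hb : b.length = 0) :
    compG k R 1 (bar k R 1 a [v] b) ∈ suppOn k (BzTriple.SplitsAtArrow v.arrows) := by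
  have ha' : a.arrows = [] := List.length_eq_zero_iff.1 ha
  have hb' : b.arrows = [] := List.length_eq_zero_iff.1 hb
  unfold bar
  split_ifs with hv
  · rw [compG, Finsupp.linearCombination_single, one_smul]
    refine bzAct_mem (P := BzTriple.SplitsAtArrow v.arrows) ?_ ?_
    · simp only [compGAux, Nat.not_even_one, if_false]
      split_ifs
      · refine Submodule.sum_mem _ fun i _ => Submodule.sum_mem _ fun j _ => ?_
        split_ifs with h
        · refine bz_mem fun hz => ⟨hz.isAP.2, ?_⟩
          simp only [concatAll, List.flatMap_cons, List.flatMap_nil, List.append_nil, Word.sub,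
            Word.length, List.take_length, List.drop_zero]
          have hij := h.1.1
          conv_rhs => rw [← List.take_append_drop j v.arrows, ← List.take_append_drop i
            (v.arrows.take j), List.take_take, min_eq_left hij]
        · exact Submodule.zero_mem _
      · exact Submodule.zero_mem _
    · rintro c ⟨h1, h2⟩
      exact ⟨h1, by simpa [Word.comp, ha', hb'] using h2⟩
  · rw [map_zero]
    exact Submodule.zero_mem _

/-- G_1 admits only starts strictly before the end of the first entry; for an arrow this leaves
position 0. -/
lemma compG_one_arrow_mem (a v b : Word V) (ha : a.length = 0) (hv1 : v.length = 1) :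
    compG k R 1 (bar k R 1 a [v] b) ∈ suppOn k BzTriple.LeftTrivial := by
  unfold bar
  split_ifs with hv
  · rw [compG, Finsupp.linearCombination_single, one_smul]
    refine bzAct_mem (P := BzTriple.LeftTrivial) ?_ ?_
    · simp only [compGAux, Nat.not_even_one, if_false]
      split_ifs
      · refine Submodule.sum_mem _ fun i _ => Submodule.sum_mem _ fun j _ => ?_
        split_ifs with h
        · refine bz_mem fun hz => ?_
          have hi : i < 1 := hv1 ▸ h.2
          simp only [BzTriple.LeftTrivial, Word.sub, Word.length, List.length_drop,
            List.length_take]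
          omega
        · exact Submodule.zero_mem _
      · exact Submodule.zero_mem _
    · intro c hc
      simp only [BzTriple.LeftTrivial, Word.length, Word.comp, List.length_append] at hc ha ⊢
      omega
  · rw [map_zero]
    exact Submodule.zero_mem _

/-- The support of `G_2 (1 ⊗ v ⊗ w ⊗ 1)` for a tame product `v w`. -/
lemma compG_two_leftTrivial (a b v w : Word V) (ha : a.length = 0)
    (hvw : Tame R (v.comp w)) :
    compG k R 2 (bar k R 2 a [v, w] b) ∈ suppOn k BzTriple.LeftTrivial := by
  -- If vw is nonzero, the pair condition in G_2 fails and the value is 0; otherwise tameness makes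
  -- vw itself a relation.
  by_cases hI : InIdeal R (v.comp w)
  swap
  · rw [compG_eq_zero (by simp [PairsInIdeal, hI])]
    exact Submodule.zero_mem _
  have hR : v.comp w ∈ R := hvw.2.resolve_left (not_not.2 hI)
  unfold bar
  split_ifs with hv
  · rw [compG, Finsupp.linearCombination_single, one_smul]
    refine bzAct_mem (P := BzTriple.LeftTrivial) ?_ ?_
    · have hT : concatAll a.tgt [v, w] = v.comp w := by
        ext1
        · exact hv.chain.1.symm
        · simp [concatAll, Word.comp]
      simp only [compGAux, hT, even_two, if_true]
      split_ifs
      · refine Submodule.sum_mem _ fun i _ => Submodule.sum_mem _ fun j _ => ?_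
        split_ifs with h
        · refine bz_mem fun hz => ?_
          -- The whole path vw is an element of AP_2 starting at 0, so the smallest start is 0.
          have hi : i ≤ 0 := h.2 0 (v.comp w).length
            ⟨Nat.zero_le _, le_rfl, by
              rw [Word.sub_self_length]; exact (isAP_two_iff hvw.1).2 hR⟩
          simp only [BzTriple.LeftTrivial, Word.sub, Word.length, List.length_drop,
            List.length_take]
          omega
        · exact Submodule.zero_mem _
      · exact Submodule.zero_mem _
    · intro c hc
      simp only [BzTriple.LeftTrivial, Word.length, Word.comp, List.length_append] at hc ha ⊢
      omega
  · rw [map_zero]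
    exact Submodule.zero_mem _

/-- The d-term of the recursion disappears because H_0 = 0. -/
lemma homotopy_one_bar {a v b : Word V} :
    homotopy k R 1 (bar k R 1 a [v] b) =
      if BarTuple.Valid R 1 ⟨a, [v], b⟩ then
        barAct k R 2 a (Word.triv b.tgt) (barS k R 1 (compF k R 1 (compG k R 1
          (bar k R 1 (Word.triv a.tgt) [v] b)))) else 0 := by
  rw [bar]
  split_ifs with hv
  · rw [homotopy, Finsupp.linearCombination_single, one_smul]
    simp [homotopy]
  · exact map_zero _

lemma homotopy_one_arrow (a v b : Word V) (hv : v.length = 1) :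
    homotopy k R 1 (bar k R 1 a [v] b) = 0 := by
  rw [homotopy_one_bar]
  split_ifs
  · rw [barS_eq_zero (compF_leftTrivial (compG_one_arrow_mem _ _ _ rfl hv)), map_zero]
  · rfl

/-- `a ⊗ L ⊗ c ⊗ R` with `c` an arrow and `L c R` a given path. -/
def BarTuple.SplitsAtArrow (a l : List (Total V)) (c : BarTuple V) : Prop :=
  ∃ L e : Word V, c.left.arrows = a ∧ c.mid = [L, e] ∧ e.length = 1 ∧
    L.arrows ++ e.arrows ++ c.right.arrows = l

/-- G_1 cuts v at each arrow as L e R, F_1 leaves the arrow alone, and s moves L into the middle. -/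
lemma homotopy_one_mem (a v b : Word V) (hb : b.length = 0) :
    homotopy k R 1 (bar k R 1 a [v] b) ∈ suppOn k (BarTuple.SplitsAtArrow a.arrows v.arrows) := by
  rw [homotopy_one_bar]
  split_ifs
  · refine barAct_mem (P := BarTuple.SplitsAtArrow [] v.arrows) (barS_mem (P := fun c =>
      ∃ e : Word V, c.mid = [e] ∧ e.length = 1 ∧
        c.left.arrows ++ e.arrows ++ c.right.arrows = v.arrows)
      (compF_one_mem (compG_one_mem _ _ _ rfl hb) ?_) ?_) ?_
    · rintro c ⟨h1, h2⟩
      exact ⟨c.mid, rfl, h1, by simpa [Word.comp, Word.triv] using h2⟩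
    · rintro c ⟨e, h1, h2, h3⟩ -
      exact ⟨c.left, e, rfl, by rw [h1], h2, h3⟩
    · rintro c ⟨L, e, h1, h2, h3, h4⟩
      exact ⟨L, e, by simp [Word.comp, h1], h2, h3, by simpa [Word.comp, Word.triv] using h4⟩
  · exact Submodule.zero_mem _

/-- `1 ⊗ v ⊗ L ⊗ c ⊗ R` with `c` an arrow and `L c R` a given path. -/
def BarTuple.RefinesAtArrow (p l : List (Total V)) (c : BarTuple V) : Prop :=
  c.left.length = 0 ∧ ∃ P L e : Word V, c.mid = [P, L, e] ∧ P.arrows = p ∧ e.length = 1 ∧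
    L.arrows ++ e.arrows ++ c.right.arrows = l

/-- The recursion for H with the bar differential cut down to its first face, the only one that
survives s H. -/
lemma homotopy_succ_single {n : ℕ} {a v b : Word V} {l : List (Word V)}
    (h : BarTuple.Valid R (n + 1) ⟨a, v :: l, b⟩)
    (h' : BarTuple.Valid R (n + 1) ⟨Word.triv a.tgt, v :: l, b⟩) :
    homotopy k R (n + 1) (Finsupp.single ⟨⟨a, v :: l, b⟩, h⟩ 1) =
      barAct k R (n + 2) a (Word.triv b.tgt)
        (barS k R (n + 1) (compF k R (n + 1) (compG k R (n + 1)
            (bar k R (n + 1) (Word.triv a.tgt) (v :: l) b)))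
          - barS k R (n + 1) (homotopy k R n (bar k R n ((Word.triv a.tgt).comp v) l b))) := by
  rw [homotopy, Finsupp.linearCombination_single, one_smul]
  simp only
  rw [← barS_homotopy_barD h' rfl, bar, dif_pos h']

lemma BarTuple.Valid.triv_left (hR : IsMonomialPresentation R) {n : ℕ} {a b : Word V}
    {l : List (Word V)} (h : BarTuple.Valid R n ⟨a, l, b⟩) :
    BarTuple.Valid R n ⟨Word.triv a.tgt, l, b⟩ :=
  ⟨hR.nonzeroPath_triv _, h.right_nonzero, h.length_mid, h.chain, h.last⟩

/-- `H_2` on `a ⊗ v ⊗ w ⊗ b` for a tame product `v w`. -/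
lemma homotopy_two_bar (hR : IsMonomialPresentation R) {a v w b : Word V}
    (hvw : Tame R (v.comp w)) :
    homotopy k R 2 (bar k R 2 a [v, w] b) =
      if BarTuple.Valid R 2 ⟨a, [v, w], b⟩ then
        - barAct k R 3 a (Word.triv b.tgt) (barS k R 2 (homotopy k R 1
          (bar k R 1 ((Word.triv a.tgt).comp v) [w] b))) else 0 := by
  rw [bar]
  split_ifs with h
  · rw [homotopy_succ_single h (h.triv_left hR),
      barS_eq_zero (compF_leftTrivial (compG_two_leftTrivial _ _ _ _ rfl hvw)), zero_sub, map_neg]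
  · exact map_zero _

/-- `H_2 (a ⊗ v ⊗ β ⊗ b) = 0` for an arrow `β` and a tame product `v β`. -/
lemma homotopy_two_arrow (hR : IsMonomialPresentation R) {a v w b : Word V}
    (hvw : Tame R (v.comp w)) (hw : w.length = 1) :
    homotopy k R 2 (bar k R 2 a [v, w] b) = 0 := by
  rw [homotopy_two_bar hR hvw, homotopy_one_arrow _ _ _ hw]
  simp

lemma homotopy_two_mem (hR : IsMonomialPresentation R) {a v w b : Word V}
    (hvw : Tame R (v.comp w)) (ha : a.length = 0) (hb : b.length = 0) :
    homotopy k R 2 (bar k R 2 a [v, w] b) ∈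
      suppOn k (BarTuple.RefinesAtArrow v.arrows w.arrows) := by
  rw [homotopy_two_bar hR hvw]
  split_ifs with h
  · refine Submodule.neg_mem _ (barAct_mem (P := BarTuple.RefinesAtArrow v.arrows w.arrows)
      (barS_mem (homotopy_one_mem _ _ _ hb) ?_) ?_)
    · rintro c ⟨L, e, h1, h2, h3, h4⟩ -
      exact ⟨rfl, c.left, L, e, by rw [h2], by simpa [Word.comp, Word.triv] using h1, h3, h4⟩
    · rintro c ⟨h0, h1⟩
      refine ⟨?_, by simpa [Word.comp, Word.triv] using h1⟩
      simp only [Word.length, Word.comp, List.length_append] at h0 ha ⊢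
      omega
  · exact Submodule.zero_mem _

/-- `H_3 (a ⊗ u ⊗ v ⊗ β ⊗ b) = 0` for an arrow `β` and a nonzero product `v β`. -/
lemma homotopy_three_arrow (hR : IsMonomialPresentation R) {a u v w b : Word V}
    (hvw : Tame R (v.comp w)) (hI : ¬ InIdeal R (v.comp w)) (hw : w.length = 1) :
    homotopy k R 3 (bar k R 3 a [u, v, w] b) = 0 := by
  rw [bar]
  split_ifs with h
  · rw [homotopy_succ_single h (h.triv_left hR),
      -- In odd arity the second and third entries are paired, so G_3 requires vw to be in I. The
      -- d-term is s H_2 of u ⊗ v ⊗ w ⊗ b, which vanishes because w is an arrow.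
      compG_eq_zero (by
        rw [if_neg (show ¬ Even (2 + 1) from Nat.not_even_iff_odd.2 ⟨1, rfl⟩)]
        simp [PairsInIdeal, hI]),
      homotopy_two_arrow hR hvw hw]
    simp
  · exact map_zero _

end Homotopy

-- Multiplication in A and the vertex idempotents

section Algebra

variable {V : Type*} [Quiver V] {k : Type*} [Field k] {R : Set (Word V)}

/-- The multiplication of `A` as a bilinear map. -/
def mulHom (k : Type*) [Field k] (R : Set (Word V)) : Alg k R →ₗ[k] Alg k R →ₗ[k] Alg k R :=
  LinearMap.mk₂ k (mul k R)
    (fun x x' y => by simp [mul])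
    (fun c x y => by simp [mul])
    (fun x y y' => by
      simp only [mul, map_add, Finsupp.linearCombination_apply, smul_add]
      exact Finsupp.sum_add)
    (fun c x y => by
      simp only [mul, map_smul, Finsupp.linearCombination_apply, Finsupp.smul_sum]
      exact Finsupp.sum_congr fun p _ => Finsupp.sum_congr fun q _ => smul_comm _ _ _)

lemma mulHom_apply (x y : Alg k R) : mulHom k R x y = mul k R x y := LinearMap.mk₂_apply ..

lemma mul_zero_right (x : Alg k R) : mul k R x 0 = 0 := by
  rw [← mulHom_apply, map_zero]

lemma mul_zero_left (y : Alg k R) : mul k R 0 y = 0 := by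
  rw [← mulHom_apply, map_zero, LinearMap.zero_apply]

/-- `a ↦ e_x a e_y`. -/
def sandwich (k : Type*) [Field k] (R : Set (Word V)) (x y : V) : Alg k R →ₗ[k] Alg k R :=
  (mulHom k R (cls k R (Word.triv x))) ∘ₗ (mulHom k R).flip (cls k R (Word.triv y))

lemma sandwich_apply (x y : V) (a : Alg k R) :
    sandwich k R x y a = mul k R (cls k R (Word.triv x)) (mul k R a (cls k R (Word.triv y))) :=
  rfl

lemma cls_of_nonzeroPath {p : Word V} (h : NonzeroPath R p) :
    cls k R p = Finsupp.single ⟨p, h⟩ 1 := dif_pos h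

lemma comp_triv (p : Word V) (x : V) : p.comp (Word.triv x) = p := by
  ext1 <;> simp [Word.comp, Word.triv]

lemma triv_comp (p : Word V) : (Word.triv p.src).comp p = p := by
  ext1 <;> simp [Word.comp, Word.triv]

lemma mul_cls_triv (hR : IsMonomialPresentation R) {a : Alg k R} {y : V}
    (h : ∀ p ∈ a.support, p.1.tgt = y) : mul k R a (cls k R (Word.triv y)) = a := by
  rw [cls_of_nonzeroPath (hR.nonzeroPath_triv y), mul, Finsupp.linearCombination_apply]
  conv_rhs => rw [← Finsupp.sum_single a]
  refine Finsupp.sum_congr fun p hp => ?_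
  rw [Finsupp.linearCombination_single, one_smul,
    if_pos (show p.1.tgt = (Word.triv y).src from h p hp), comp_triv,
    cls_of_nonzeroPath p.2, Finsupp.smul_single, smul_eq_mul, mul_one]

lemma cls_triv_mul (hR : IsMonomialPresentation R) {a : Alg k R} {x : V}
    (h : ∀ p ∈ a.support, p.1.src = x) : mul k R (cls k R (Word.triv x)) a = a := by
  rw [cls_of_nonzeroPath (hR.nonzeroPath_triv x), mul, Finsupp.linearCombination_single, one_smul,
    Finsupp.linearCombination_apply]
  conv_rhs => rw [← Finsupp.sum_single a]
  refine Finsupp.sum_congr fun p hp => ?_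
  obtain rfl := h p hp
  rw [if_pos (show (Word.triv p.1.src).tgt = p.1.src from rfl), triv_comp,
    cls_of_nonzeroPath p.2, Finsupp.smul_single, smul_eq_mul, mul_one]

lemma sandwich_eq_self (hR : IsMonomialPresentation R) {a : Alg k R} {x y : V}
    (h : ∀ p ∈ a.support, p.1.src = x ∧ p.1.tgt = y) : sandwich k R x y a = a := by
  rw [sandwich_apply, mul_cls_triv hR fun p hp => (h p hp).2, cls_triv_mul hR fun p hp => (h p hp).1]

/-- The product of two path classes is either 0 or the class of the concatenation. -/
lemma ProdNeZero.nonzeroPath {p q : Word V} (h : ProdNeZero k R p q) :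
    NonzeroPath R (p.comp q) := by
  by_contra hpq
  apply h
  unfold cls
  split_ifs <;> simp [mul, cls, hpq]

end Algebra

-- Bimodule extensions and pullbacks of cochains

section Hats

variable {V : Type*} [Quiver V] {k : Type*} [Field k] {R : Set (Word V)}

lemma hat_eq_zero {n : ℕ} {f : HochCochain k R n} {P : BarTuple V → Prop} {x : Bar k R n}
    (hx : x ∈ suppOn k P)
    (h : ∀ c : BarTuple V, c.Valid R n → P c → f.ev c.left.tgt c.mid = 0) : f.hat x = 0 := by
  rw [← Submodule.mem_bot k]
  refine linearCombination_mem_of_suppOn hx fun c hc => ?_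
  rw [Submodule.mem_bot, h c.1 c.2 hc, mul_zero_left, mul_zero_right]

/-- Cochains are not required to be E-bilinear, so the units 1 ⊗ - ⊗ 1 act as vertex idempotents
that need not be absorbed by the value. -/
lemma hat_oneTensor (hR : IsMonomialPresentation R) {n : ℕ} (f : HochCochain k R n) (x : V)
    (l : List (Word V)) :
    f.hat (oneTensor k R n x l) = sandwich k R x (listEnd x l) (f.ev x l) := by
  rw [oneTensor, bar]
  split_ifs with h
  · rw [HochCochain.hat, Finsupp.linearCombination_single, one_smul]
    rfl
  · have h' : f.ev x l = 0 := by
      refine dif_neg fun hl => h ?_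
      exact ⟨hR.nonzeroPath_triv _, hR.nonzeroPath_triv _, hl.1, hl.2, rfl⟩
    rw [map_zero, h', map_zero]

lemma starG_ev_eq_zero (g : BzElt k R) {N : ℕ} {x : V} {l : List (Word V)}
    (h : ¬ PairsInIdeal R (if Even N then l else l.tail)) : (starG g N).ev x l = 0 := by
  unfold HochCochain.ev
  split_ifs
  · unfold starG
    split_ifs
    · rw [oneTensor, compG_eq_zero h, map_zero]
    · rfl
  · rfl

lemma starH_ev_eq_zero {F : HochTotal k R} {N : ℕ} {x : V} {l : List (Word V)}
    (h : RadChain R x l → (F (N + 1)).hat (homotopy k R N (oneTensor k R N x l)) = 0) :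
    (starH F N).ev x l = 0 := by
  unfold HochCochain.ev
  split_ifs with hl
  · rw [starH, h hl.2, smul_zero]
  · rfl

lemma bzAct_bz {w : Word V} :
    bzAct k R 2 (Word.triv w.src) (Word.triv w.tgt)
      (bz k R 2 (Word.triv w.src) w (Word.triv w.tgt)) =
      bz k R 2 (Word.triv w.src) w (Word.triv w.tgt) := by
  by_cases h : BzTriple.Valid R 2 ⟨Word.triv w.src, w, Word.triv w.tgt⟩
  · conv_lhs => rw [bz, dif_pos h]
    rw [bzAct, Finsupp.linearCombination_single, one_smul, if_pos ⟨rfl, rfl⟩]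
    rfl
  · rw [bz, dif_neg h, map_zero]

/-- `G_2 (1 ⊗ v ⊗ w ⊗ 1) = 1 ⊗ vw ⊗ 1` for a relation `v w`. -/
lemma compG_two_of_mem (hR : IsMonomialPresentation R) {v w : Word V} (hvw : v.comp w ∈ R)
    (hc : RadChain R v.src [v, w]) :
    compG k R 2 (oneTensor k R 2 v.src [v, w]) =
      bz k R 2 (Word.triv (v.comp w).src) (v.comp w) (Word.triv (v.comp w).tgt) := by
  have hpath := hR.isPath _ hvw
  have htgt : (v.comp w).tgt = w.tgt := by
    rw [Word.tgt, Word.comp, walkEnd_append, Word.tgt, hc.2.2.2.1]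
    rfl
  have hT : concatAll v.src [v, w] = v.comp w := by
    ext1
    · rfl
    · simp [concatAll, Word.comp]
  have hval : BarTuple.Valid R 2 ⟨Word.triv v.src, [v, w], Word.triv (listEnd v.src [v, w])⟩ :=
    ⟨hR.nonzeroPath_triv _, hR.nonzeroPath_triv _, rfl, hc, rfl⟩
  have hap : ∀ i j, APAt R 2 (v.comp w) i j ↔ i = 0 ∧ j = (v.comp w).length := by
    intro i j
    constructor
    · rintro ⟨h1, h2, h3⟩
      exact hR.minimal _ hvw i j ⟨h1, h2, (isAP_two_iff h3.1).1 h3⟩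
    · rintro ⟨rfl, rfl⟩
      exact ⟨Nat.zero_le _, le_rfl, by
        rw [Word.sub_self_length]; exact (isAP_two_iff hpath).2 hvw⟩
  have hsum : compGAux k R 2 v.src [v, w] =
      bz k R 2 (Word.triv (v.comp w).src) (v.comp w) (Word.triv (v.comp w).tgt) := by
    have hI : InIdeal R (v.comp w) := ⟨_, _, relAt_of_mem hvw⟩
    simp only [compGAux, hT, even_two, if_true, hap]
    rw [if_pos ⟨hI, trivial⟩]
    rw [Finset.sum_eq_single 0, Finset.sum_eq_single (v.comp w).length, if_pos, Word.sub_self_length]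
    · congr 1
      ext1 <;> simp [Word.sub, Word.triv, Word.tgt, Word.length]
    · exact ⟨⟨rfl, rfl⟩, fun _ _ _ => Nat.zero_le _⟩
    · intro j _ hj
      exact if_neg fun h => hj h.1.2
    · intro h
      simp at h
    · intro i _ hi
      exact Finset.sum_eq_zero fun j _ => if_neg fun h => hi h.1.1
    · intro h
      simp at h
  rw [oneTensor, bar, dif_pos hval, compG, Finsupp.linearCombination_single, one_smul]
  refine Eq.trans ?_ bzAct_bz
  rw [htgt]
  simp only
  rw [← htgt, ← hsum, htgt]
  rfl

/-- `φ_1 (f) (1 ⊗ v ⊗ w ⊗ 1) = f (v w)` for a tame product `v w`. -/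
lemma starG_ev_tame (hR : IsMonomialPresentation R) (f : bardzellCochains k R 2) {v w : Word V}
    (hvw : Tame R (v.comp w)) (hc : RadChain R v.src [v, w]) :
    (starG (ofDegreeOne f) 2).ev v.src [v, w] = BzCochain.ev f.1 (v.comp w) := by
  by_cases hI : InIdeal R (v.comp w)
  · have hmem : v.comp w ∈ R := hvw.2.resolve_left (not_not.2 hI)
    have hap : IsAP R 2 (v.comp w) := (isAP_two_iff hvw.1).2 hmem
    have hval : BzTriple.Valid R 2
        ⟨Word.triv (v.comp w).src, v.comp w, Word.triv (v.comp w).tgt⟩ :=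
      ⟨hR.nonzeroPath_triv _, hR.nonzeroPath_triv _, hap, rfl, rfl⟩
    rw [HochCochain.ev, dif_pos ⟨rfl, hc⟩, starG,
      dif_pos (show (ofDegreeOne f).1 = 2 from rfl)]
    simp only [ofDegreeOne]
    rw [compG_two_of_mem hR hmem hc, bz, dif_pos hval, BzCochain.hat,
      Finsupp.linearCombination_single, one_smul]
    change mul k R (cls k R (Word.triv _)) (mul k R (BzCochain.ev f.1 (v.comp w))
      (cls k R (Word.triv _))) = _
    rw [← sandwich_apply]
    refine sandwich_eq_self hR fun p hp => ?_
    simp only [BzCochain.ev, dif_pos hap] at hp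
    exact f.2 ⟨_, hap⟩ p hp
  · rw [starG_ev_eq_zero]
    · rw [BzCochain.ev, dif_neg]
      exact fun h => hI ⟨_, _, relAt_of_mem ((isAP_two_iff hvw.1).1 h)⟩
    · simp [PairsInIdeal, hI]

end Hats

-- Vanishing of φ_n on tame pairs

section Vanishing

variable {V : Type*} [Quiver V] {k : Type*} [Field k] {R : Set (Word V)}

lemma RadChain.isPath_comp {x : V} {p q : Word V} {l : List (Word V)}
    (h : RadChain R x (p :: q :: l)) : (p.comp q).IsPath := by
  obtain ⟨-, -, h1, h2, -, h3, -⟩ := h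
  refine (isWalk_append _ _ _).2 ⟨h1.1, ?_⟩
  have := h3.1
  rwa [Word.IsPath, h2] at this

lemma arityPhi_eq_two {n : ℕ} {f : Fin n → BzElt k R} (hf : ∀ i, (f i).1 = 2) :
    arityPhi f = 2 := by
  have : ∑ i, BzElt.deg (f i) = n := by simp [BzElt.deg, hf]
  rw [arityPhi, this]
  omega

lemma gerstProd_apply_two (g h : HochCochain k R 2) {x : V} {u v w : Word V}
    (hc : [u, v, w].length = 3 ∧ RadChain R x [u, v, w]) :
    gerstProd g h 3 ⟨(x, [u, v, w]), hc⟩ =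
      Finsupp.linearCombination k (fun p : {p : Word V // NonzeroPath R p} => g.ev x [p.1, w])
        (h.ev x [u, v]) -
      Finsupp.linearCombination k (fun p : {p : Word V // NonzeroPath R p} => g.ev x [u, p.1])
        (h.ev u.tgt [v, w]) := by
  simp only [gerstProd]
  rw [if_pos trivial, Finset.sum_range_succ, Finset.sum_range_one]
  simp [listEnd, sub_eq_add_neg, pow_succ]

/-- Both shifted degrees are 1, so the bracket is the symmetric sum. -/
lemma gerstBracket_apply_two (g h : HochCochain k R 2) (c) :
    gerstBracket g h 3 c = gerstProd g h 3 c + gerstProd h g 3 c := by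
  simp [gerstBracket, sign, sub_eq_add_neg, Int.negOnePow_one]

lemma gerstProd_eq_zero (g h : HochCochain k R 2) {x : V} {u v w : Word V}
    (hc : [u, v, w].length = 3 ∧ RadChain R x [u, v, w])
    (h1 : h.ev x [u, v] = 0) (h2 : h.ev u.tgt [v, w] = 0) :
    gerstProd g h 3 ⟨(x, [u, v, w]), hc⟩ = 0 := by
  rw [gerstProd_apply_two, h1, h2, map_zero, map_zero, sub_zero]

/-- With all shifted degrees 1, every φ_t of the arguments again has arity 2, which removes the
arity bookkeeping. -/
lemma vMap_apply {n : ℕ} {f : Fin n → BzElt k R} (hf : ∀ i, (f i).1 = 2) (N : ℕ) (c) :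
    vMap n f N c = ∑ t : Fin n, if 1 ≤ t.1 then
      ∑ τ ∈ unshufflesMinus n t.1, (chi τ f * kappa τ t.1 f) •
        gerstBracket (phiMap t.1 (firstPart τ t.1 t.2.le f) 2)
          (phiMap (n - t.1) (lastPart τ t.1 f) 2) N c
    else 0 := by
  rw [vMap, Finset.sum_apply, Finset.sum_apply]
  refine Finset.sum_congr rfl fun t _ => ?_
  split_ifs
  · rw [Finset.sum_apply, Finset.sum_apply]
    refine Finset.sum_congr rfl fun τ _ => ?_
    rw [arityPhi_eq_two (f := firstPart τ t.1 t.2.le f) fun _ => hf _,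
      arityPhi_eq_two (f := lastPart τ t.1 f) fun _ => hf _]
    rfl
  · rfl

/-- The number of arguments is often 1 only up to arithmetic, as in m + 1 - m, so it enters through
an equation. -/
lemma phiMap_eq_starG {n : ℕ} (hn : n = 1) (f : Fin n → BzElt k R) :
    phiMap n f = starG (f ⟨0, by omega⟩) := by
  subst hn
  rw [phiMap]
  rfl

lemma phiMap_eq_starH {n : ℕ} (hn : 2 ≤ n) (f : Fin n → BzElt k R) :
    phiMap n f = starH (uMap n f + vMap n f) := by
  obtain ⟨n, rfl⟩ := Nat.exists_eq_add_of_le' hn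
  rw [phiMap]

/-- `φ_n` vanishes on `u ⊗ v ⊗ β` for an arrow `β` with `v β` nonzero in `A`. -/
lemma phiMap_three_ev (hR : IsMonomialPresentation R) (n : ℕ) (f : Fin n → BzElt k R) {x : V}
    {u v w : Word V} (hI : ¬ InIdeal R (v.comp w)) (hw : w.length = 1) :
    (phiMap n f 3).ev x [u, v, w] = 0 := by
  match n with
  | 0 =>
    rw [phiMap]
    unfold HochCochain.ev
    split_ifs <;> rfl
  | 1 =>
    rw [phiMap_eq_starG rfl]
    refine starG_ev_eq_zero _ ?_
    rw [if_neg (show ¬ Even 3 from Nat.not_even_iff_odd.2 ⟨1, rfl⟩)]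
    simp [PairsInIdeal, hI]
  | n + 2 =>
    rw [phiMap_eq_starH (by omega)]
    refine starH_ev_eq_zero fun hc => ?_
    rw [oneTensor, homotopy_three_arrow hR ⟨hc.2.2.2.isPath_comp, Or.inl hI⟩ hI hw, map_zero]

/-- `φ_n` vanishes on `v ⊗ β` for an arrow `β` and a tame product `v β`, when `n ≥ 2`. -/
lemma phiMap_two_ev_arrow (hR : IsMonomialPresentation R) {n : ℕ} (hn : 2 ≤ n)
    (f : Fin n → BzElt k R) {x : V} {v w : Word V} (hvw : Tame R (v.comp w))
    (hw : w.length = 1) : (phiMap n f 2).ev x [v, w] = 0 := by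
  rw [phiMap_eq_starH hn]
  refine starH_ev_eq_zero fun hc => ?_
  rw [oneTensor, homotopy_two_arrow hR hvw hw, map_zero]

/-- Every summand of u_n is some φ_j, and the arity-3 vanishing of φ_j holds for arbitrary
arguments; nothing about l_k needs to be known. -/
lemma uMap_three_ev (hR : IsMonomialPresentation R) (n : ℕ) (f : Fin n → BzElt k R) {x : V}
    {u v w : Word V} (hI : ¬ InIdeal R (v.comp w)) (hw : w.length = 1) :
    (uMap n f 3).ev x [u, v, w] = 0 := by
  unfold HochCochain.ev
  split_ifs with hc
  · rw [uMap, Finset.sum_apply, Finset.sum_apply]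
    refine Finset.sum_eq_zero fun j _ => ?_
    split_ifs
    · rw [Finset.sum_apply, Finset.sum_apply]
      refine Finset.sum_eq_zero fun τ _ => ?_
      have h := phiMap_three_ev hR (n - j.1 + 1)
        (Fin.cons (α := fun _ => BzElt k R)
          (lMap j.1 (firstPart τ j.1 (Nat.le_of_lt_succ j.2) f)) (lastPart τ j.1 f))
        (x := x) (u := u) hI hw
      rw [HochCochain.ev, dif_pos hc] at h
      rw [Pi.smul_apply, Pi.smul_apply, h, smul_zero]
    · rfl
  · rfl

/-- The refinements of `u ⊗ v` that occur in `H_2 (1 ⊗ u ⊗ v ⊗ 1)` have nonzero products. -/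
lemma refines_spec (hR : IsMonomialPresentation R) {x : V} {u v : Word V}
    (hc : RadChain R x [u, v]) (huv : Tame R (u.comp v)) {c : BarTuple V} (hval : c.Valid R 3)
    (h : c.RefinesAtArrow u.arrows v.arrows) :
    ∃ L e : Word V, c.mid = [u, L, e] ∧ c.left.tgt = x ∧ e.length = 1 ∧
      ¬ InIdeal R (u.comp L) ∧ ¬ InIdeal R (L.comp e) := by
  obtain ⟨-, P, L, e, hmid, hP, he, hv⟩ := h
  have hch := hval.chain
  rw [hmid] at hch
  obtain ⟨hu0, hu1, hu2, hv0, hv1, hv2, -⟩ := hc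
  obtain ⟨hP0, -, hP2, hL0, -, -, -⟩ := hch
  -- Equal arrow lists do not yet give equal words; the first arrow of a path of positive length
  -- fixes its source.
  have hsrc : P.src = u.src := by
    obtain ⟨a, l, hal⟩ : ∃ a l, u.arrows = a :: l :=
      List.exists_cons_of_length_pos hu1
    have h1 := hP2.1
    have h2 := hu2.1
    simp only [Word.IsPath, hP, hal, IsWalk] at h1 h2
    rw [← h1.1, ← h2.1]
  have hPu : P = u := Word.ext hsrc hP
  subst hPu
  refine ⟨L, e, hmid, hP0.symm.trans hu0, he, ?_, ?_⟩
  -- The arrow e makes uL a proper prefix of the tame path uv.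
  · have h1 : P.comp v = ⟨P.src, (P.arrows ++ L.arrows) ++ (e.arrows ++ c.right.arrows)⟩ := by
      simp [Word.comp, ← hv]
    rw [h1] at huv
    refine huv.not_inIdeal_prefix hR fun h0 => ?_
    rw [List.append_eq_nil_iff] at h0
    simp [Word.length, h0.1] at he
  · rintro ⟨i, j, hij⟩
    have h2 : v = ⟨L.src, (L.arrows ++ e.arrows) ++ c.right.arrows⟩ :=
      Word.ext (hv0.trans hL0.symm) hv.symm
    exact hv2.2 ⟨i, j, h2 ▸ hij.append_right _⟩

/-- If `v_n` vanishes on the `u ⊗ L ⊗ e` with `e` an arrow and `u L`, `L e` nonzero in `A`, then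
`φ_n` vanishes on `u ⊗ v` for a tame product `u v`. -/
lemma phiMap_two_ev_of_vMap (hR : IsMonomialPresentation R) {n : ℕ} (hn : 2 ≤ n)
    {f : Fin n → BzElt k R} {x : V} {u v : Word V} (huv : Tame R (u.comp v))
    (hV : ∀ L e : Word V, ¬ InIdeal R (u.comp L) → ¬ InIdeal R (L.comp e) → e.length = 1 →
      (vMap n f 3).ev x [u, L, e] = 0) : (phiMap n f 2).ev x [u, v] = 0 := by
  rw [phiMap_eq_starH hn]
  refine starH_ev_eq_zero fun hc => ?_
  refine hat_eq_zero (homotopy_two_mem hR huv rfl rfl) fun c hval hP => ?_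
  obtain ⟨L, e, hmid, htgt, he, h1, h2⟩ := refines_spec hR hc huv hval hP
  rw [hmid, htgt]
  have hu := uMap_three_ev hR n f (x := x) (u := u) h2 he
  have hv := hV L e h1 h2 he
  unfold HochCochain.ev at hu hv ⊢
  split_ifs at hu hv ⊢
  · rw [Pi.add_apply, Pi.add_apply, hu, hv, add_zero]
  · rfl

/-- `v_n (f_1, …, f_n)` vanishes on `u ⊗ v ⊗ β` for arguments of arity two, an arrow `β` and
nonzero products `u v` and `v β`. -/
lemma vMap_three_ev (hR : IsMonomialPresentation R) (n : ℕ) (f : Fin n → BzElt k R)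
    (hf : ∀ i, (f i).1 = 2) {x : V} {u v w : Word V} (huv : ¬ InIdeal R (u.comp v))
    (hvw : ¬ InIdeal R (v.comp w)) (hw : w.length = 1) : (vMap n f 3).ev x [u, v, w] = 0 := by
  induction n using Nat.strong_induction_on generalizing x u v w with
  | _ n ih =>
  unfold HochCochain.ev
  split_ifs with hc
  swap
  · rfl
  -- Every φ_s occurring in v_n has s < n and vanishes on both inner pairs: for s = 1 because G_2
  -- needs a product in I, for s ≥ 2 on u ⊗ v by induction through v_s, and on v ⊗ w because w is an
  -- arrow.
  have key : ∀ s, 1 ≤ s → s < n → ∀ g : Fin s → BzElt k R, (∀ i, (g i).1 = 2) →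
      (phiMap s g 2).ev x [u, v] = 0 ∧ (phiMap s g 2).ev u.tgt [v, w] = 0 := by
    intro s hs hsn g hg
    rcases hs.eq_or_lt with rfl | hs2
    · rw [phiMap_eq_starG rfl]
      exact ⟨starG_ev_eq_zero _ (by simp [PairsInIdeal, huv]),
        starG_ev_eq_zero _ (by simp [PairsInIdeal, hvw])⟩
    · exact ⟨phiMap_two_ev_of_vMap hR hs2 ⟨hc.2.isPath_comp, Or.inl huv⟩
          fun L e h1 h2 he => ih s hsn g hg h1 h2 he,
        phiMap_two_ev_arrow hR hs2 _ ⟨hc.2.2.2.2.isPath_comp, Or.inl hvw⟩ hw⟩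
  rw [vMap_apply hf]
  refine Finset.sum_eq_zero fun t _ => ?_
  split_ifs with ht
  · refine Finset.sum_eq_zero fun τ _ => ?_
    have h1 := key t.1 ht t.2 (firstPart τ t.1 t.2.le f) fun _ => hf _
    have h2 := key (n - t.1) (by omega) (by omega) (lastPart τ t.1 f) fun _ => hf _
    rw [gerstBracket_apply_two, gerstProd_eq_zero _ _ _ h1.1 h1.2,
      gerstProd_eq_zero _ _ _ h2.1 h2.2, add_zero, smul_zero]
  · rfl

/-- `φ_n (f_1, …, f_n)` vanishes on `u ⊗ v` for `n ≥ 2` arguments of arity two and a tame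
product `u v`. -/
lemma phiMap_two_ev (hR : IsMonomialPresentation R) {n : ℕ} (hn : 2 ≤ n)
    {f : Fin n → BzElt k R} (hf : ∀ i, (f i).1 = 2) {x : V} {u v : Word V}
    (huv : Tame R (u.comp v)) : (phiMap n f 2).ev x [u, v] = 0 :=
  phiMap_two_ev_of_vMap hR hn huv fun _ _ h1 h2 he => vMap_three_ev hR n f hf h1 h2 he

end Vanishing

-- Unshuffles of types (1, n-1) and (n-1, 1), and their signs

section Unshuffles

variable {V : Type*} [Quiver V] {k : Type*} [Field k] {R : Set (Word V)}

/-- The permutation with values `0, …, i - 1, i + 1, …, m, i`. -/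
def moveToLast {m : ℕ} (i : Fin (m + 1)) : Equiv.Perm (Fin (m + 1)) :=
  finSuccEquivLast.trans (finSuccEquiv' i).symm

@[simp]
lemma moveToLast_last {m : ℕ} (i : Fin (m + 1)) : moveToLast i (Fin.last m) = i := by
  simp [moveToLast]

@[simp]
lemma moveToLast_castSucc {m : ℕ} (i : Fin (m + 1)) (j : Fin m) :
    moveToLast i j.castSucc = i.succAbove j := by
  simp [moveToLast]

/-- An (m,1)-unshuffle is determined by its last value, since the remaining values are listed in
increasing order. -/
lemma eq_moveToLast {m : ℕ} {τ : Equiv.Perm (Fin (m + 1))}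
    (h : τ ∈ unshuffles (m + 1) m) : τ = moveToLast (τ (Fin.last m)) := by
  have hmono : StrictMono fun j : Fin m => τ j.castSucc := fun i j hij =>
    (Finset.mem_filter.1 h).2.1 _ _ (Fin.castSucc_lt_castSucc_iff.2 hij) (by simp)
  have hrange : Set.range (fun j : Fin m => τ j.castSucc) =
      Set.range (τ (Fin.last m)).succAbove := by
    rw [Fin.range_succAbove]
    ext y
    constructor
    · rintro ⟨j, rfl⟩
      simp
    · intro hy
      obtain ⟨z, rfl⟩ := τ.surjective y
      induction z using Fin.lastCases with
      | last => exact absurd rfl hy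
      | cast j => exact ⟨j, rfl⟩
  have := (hmono.range_inj (Fin.strictMono_succAbove _)).1 hrange
  ext1 z
  induction z using Fin.lastCases with
  | last => simp
  | cast j => simpa using congrFun this j

/-- The condition τ(1) < τ(t+1) excludes exactly the unshuffle that moves index 0 to the end; that
missing term is supplied by t = 1. -/
lemma sum_unshufflesMinus_last {M : Type*} [AddCommMonoid M] {m : ℕ} (hm : 1 ≤ m)
    (F : Equiv.Perm (Fin (m + 1)) → M) :
    ∑ τ ∈ unshufflesMinus (m + 1) m, F τ = ∑ i ∈ Finset.univ.erase 0, F (moveToLast i) := by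
  symm
  refine Finset.sum_bij (fun i _ => moveToLast i) ?_ ?_ ?_ fun _ _ => rfl
  · intro i hi
    have hi0 : i ≠ 0 := (Finset.mem_erase.1 hi).1
    refine Finset.mem_filter.2 ⟨Finset.mem_filter.2 ⟨Finset.mem_univ _, ?_, ?_⟩, ?_⟩
    · intro a b hab hb
      obtain ⟨b, rfl⟩ : ∃ b' : Fin m, b = b'.castSucc := ⟨⟨b, hb⟩, rfl⟩
      obtain ⟨a, rfl⟩ : ∃ a' : Fin m, a = a'.castSucc := ⟨⟨a, lt_trans hab hb⟩, rfl⟩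
      simpa using hab
    · intro a b hab ha
      have := b.2
      have : a.1 < b.1 := hab
      omega
    · intro a b ha hb
      obtain rfl : b = Fin.last m := Fin.ext hb
      obtain rfl : a = (⟨0, hm⟩ : Fin m).castSucc := Fin.ext ha
      rw [moveToLast_last, moveToLast_castSucc, Fin.succAbove_lt_iff_castSucc_lt]
      exact Nat.pos_of_ne_zero fun h => hi0 (Fin.ext h)
  · intro i _ j _ hij
    simpa using DFunLike.congr_fun hij (Fin.last m)
  · intro τ hτ
    obtain ⟨h1, h2⟩ := Finset.mem_filter.1 hτ
    refine ⟨τ (Fin.last m), Finset.mem_erase.2 ⟨?_, Finset.mem_univ _⟩, (eq_moveToLast h1).symm⟩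
    intro h0
    have := h2 0 (Fin.last m) rfl rfl
    rw [h0] at this
    exact absurd this (Fin.not_lt_zero _)

lemma unshufflesMinus_one {n : ℕ} (hn : 2 ≤ n) : unshufflesMinus n 1 = {1} := by
  ext τ
  rw [Finset.mem_singleton]
  constructor
  · intro h
    obtain ⟨h1, h2⟩ := Finset.mem_filter.1 h
    have h3 := (Finset.mem_filter.1 h1).2.2
    have hmono : StrictMono τ := by
      intro a b hab
      rcases Nat.eq_zero_or_pos a.1 with ha | ha
      · have h01 := h2 a ⟨1, hn⟩ ha rfl
        have hb : 1 ≤ b.1 := lt_of_le_of_lt (Nat.zero_le _) (show a.1 < b.1 from hab)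
        rcases hb.eq_or_lt with hb | hb
        · rwa [show (⟨1, hn⟩ : Fin n) = b from Fin.ext hb] at h01
        · exact h01.trans (h3 _ b hb le_rfl)
      · exact h3 a b hab ha
    have := (hmono.range_inj strictMono_id).1 (by simp [τ.surjective.range_eq])
    exact Equiv.ext (congrFun this)
  · rintro rfl
    refine Finset.mem_filter.2 ⟨Finset.mem_filter.2 ⟨Finset.mem_univ _, ?_, ?_⟩, ?_⟩
    · exact fun _ _ h _ => h
    · exact fun _ _ h _ => h
    · intro i j hi hj
      change i.1 < j.1
      omega

/-- In shifted degree 1 each inversion contributes -1 to the Koszul sign, which therefore equals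
sgn(τ) and cancels it. -/
lemma chi_eq_one {n : ℕ} (τ : Equiv.Perm (Fin n)) {f : Fin n → BzElt k R}
    (hf : ∀ i, (f i).1 = 2) : chi τ f = 1 := by
  have hk : koszul τ f = (Equiv.Perm.sign τ : ℤ) := by
    have h1 : koszul τ f = ∏ p : Fin n × Fin n,
        if p.1 < p.2 ∧ τ p.2 < τ p.1 then (-1 : ℤ) else 1 := by
      rw [koszul, Finset.prod_filter]
      refine Finset.prod_congr rfl fun p _ => ?_
      simp [BzElt.deg, hf, sign, Int.negOnePow_one]
    rw [h1, Equiv.Perm.sign_eq_prod_prod_Ioi, Fintype.prod_prod_type, Units.coe_prod]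
    refine Finset.prod_congr rfl fun i _ => ?_
    rw [Units.coe_prod, ← Finset.filter_lt_eq_Ioi, Finset.prod_filter]
    refine Finset.prod_congr rfl fun j _ => ?_
    by_cases hij : i < j
    · have hne : τ i ≠ τ j := fun h => hij.ne (τ.injective h)
      rcases hne.lt_or_gt with h | h
      · simp [hij, h, h.not_gt]
      · simp [hij, h, h.not_gt]
    · simp [hij]
  rw [chi, hk, ← Units.val_mul, Int.units_mul_self, Units.val_one]

lemma kappa_one {n : ℕ} (hn : 1 ≤ n) (τ : Equiv.Perm (Fin n)) {f : Fin n → BzElt k R}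
    (hf : ∀ i, (f i).1 = 2) : kappa τ 1 f = (-1) ^ n := by
  have h : (Finset.univ.filter fun p : Fin n => p.1 < 1) = {⟨0, hn⟩} := by
    ext p
    simp [Fin.ext_iff]
  rw [kappa, h, Finset.sum_singleton, BzElt.deg, hf, sign]
  rw [show ((1 : ℕ) : ℤ) - 1 + ((n : ℤ) - (1 : ℕ) - 1) * ((2 : ℕ) - 1) = n - 2 by push_cast; ring,
    Int.negOnePow_sub, Int.negOnePow_even 2 even_two, mul_one, Int.negOnePow_def,
    zpow_natCast]
  simp

/-- For t = n - 1 the coefficient of the degree sum is 0, leaving the exponent n - 2, the same as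
for t = 1. -/
lemma kappa_last {m : ℕ} (τ : Equiv.Perm (Fin (m + 1))) (f : Fin (m + 1) → BzElt k R) :
    kappa τ m f = (-1) ^ (m + 1) := by
  rw [kappa, sign, show ((m + 1 : ℕ) : ℤ) - m - 1 = 0 by push_cast; ring, zero_mul, add_zero,
    Int.negOnePow_sub, Int.negOnePow_one, Int.negOnePow_def, zpow_natCast]
  simp [pow_succ]

end Unshuffles

-- Evaluation of v_n and comparison with A - B

section Evaluation

variable {V : Type*} [Quiver V] {k : Type*} [Field k] {R : Set (Word V)}

lemma zsmul_neg_one_pow {M : Type*} [AddCommGroup M] [Module k M] (n : ℕ) (a : M) :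
    ((-1 : ℤ) ^ n) • a = ((-1 : k) ^ n) • a := by
  rcases Nat.even_or_odd n with h | h <;> simp [h.neg_one_pow]

/-- The contribution of `f_i` to `v_n (f_1, …, f_n) (1 ⊗ u ⊗ v ⊗ w ⊗ 1)`, up to sign. -/
def omitTerm {m : ℕ} (f : Fin (m + 1) → bardzellCochains k R 2) (u v w : Word V)
    (i : Fin (m + 1)) : Alg k R :=
  Finsupp.linearCombination k
      (fun p : {p : Word V // NonzeroPath R p} => (phiOmit f i).ev u.src [p.1, w])
      (BzCochain.ev (f i).1 (u.comp v)) -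
    Finsupp.linearCombination k
      (fun p : {p : Word V // NonzeroPath R p} => (phiOmit f i).ev u.src [u, p.1])
      (BzCochain.ev (f i).1 (v.comp w))

/-- In φ_1(f_i) ∘ φ_{n-1} the inner factor vanishes on both tame pairs. In φ_{n-1} ∘ φ_1(f_i) the
inner factor evaluates f_i on uv and on vw. -/
lemma gerstBracket_phiOmit (hR : IsMonomialPresentation R) {m : ℕ} (hm : 2 ≤ m)
    (f : Fin (m + 1) → bardzellCochains k R 2) {u v w : Word V}
    (huv : Tame R (u.comp v)) (hvw : Tame R (v.comp w)) (i : Fin (m + 1))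
    (hc : [u, v, w].length = 3 ∧ RadChain R u.src [u, v, w]) :
    gerstProd (phiOmit f i) (starG (ofDegreeOne (f i)) 2) 3 ⟨(u.src, [u, v, w]), hc⟩ +
      gerstProd (starG (ofDegreeOne (f i)) 2) (phiOmit f i) 3 ⟨(u.src, [u, v, w]), hc⟩ =
      omitTerm f u v w i := by
  have hc' := hc.2
  obtain ⟨-, hu1, hu, hv0, hv1, hv, hw0, hw1, hw, -⟩ := hc'
  rw [gerstProd_eq_zero _ (phiOmit f i) hc (phiMap_two_ev hR hm (fun _ => rfl) huv)
    (phiMap_two_ev hR hm (fun _ => rfl) hvw), add_zero, gerstProd_apply_two, ← hv0,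
    starG_ev_tame hR _ huv ⟨rfl, hu1, hu, hv0, hv1, hv, trivial⟩,
    starG_ev_tame hR _ hvw ⟨rfl, hv1, hv, hw0, hw1, hw, trivial⟩]
  rfl

lemma vMap_three_tame (hR : IsMonomialPresentation R) {m : ℕ} (hm : 2 ≤ m)
    (f : Fin (m + 1) → bardzellCochains k R 2) {u v w : Word V}
    (huv : Tame R (u.comp v)) (hvw : Tame R (v.comp w))
    (hc : [u, v, w].length = 3 ∧ RadChain R u.src [u, v, w]) :
    vMap (m + 1) (fun i => ofDegreeOne (f i)) 3 ⟨(u.src, [u, v, w]), hc⟩ =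
      (-1 : k) ^ (m + 1) • ∑ i, omitTerm f u v w i := by
  have hf : ∀ i, (ofDegreeOne (f i)).1 = 2 := fun _ => rfl
  -- Only t = 1 and t = m can contribute; they are distinct because m ≥ 2.
  rw [vMap_apply hf, Fintype.sum_eq_add (⟨1, by omega⟩ : Fin (m + 1)) (Fin.last m)
    (by simp [Fin.ext_iff]; omega)]
  · have h1 : 1 ≤ (Fin.last m).1 := by simp; omega
    rw [if_pos le_rfl, if_pos h1]
    simp only [Fin.val_last]
    rw [unshufflesMinus_one (by omega), Finset.sum_singleton,
      sum_unshufflesMinus_last (by omega), chi_eq_one _ hf, kappa_one (by omega) _ hf,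
      one_mul, zsmul_neg_one_pow (k := k)]
    have hlast : ∀ i : Fin (m + 1),
        (chi (moveToLast i) (fun i => ofDegreeOne (f i)) *
          kappa (moveToLast i) m (fun i => ofDegreeOne (f i))) •
          gerstBracket
            (phiMap m (firstPart (moveToLast i) m (Fin.last m).2.le
              (fun i => ofDegreeOne (f i))) 2)
            (phiMap (m + 1 - m) (lastPart (moveToLast i) m (fun i => ofDegreeOne (f i))) 2) 3
            ⟨(u.src, [u, v, w]), hc⟩ = (-1 : k) ^ (m + 1) • omitTerm f u v w i := by
      intro i
      have hfirst : firstPart (moveToLast i) m (Fin.last m).2.le (fun i => ofDegreeOne (f i)) =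
          fun j => ofDegreeOne (f (i.succAbove j)) := by
        funext j
        exact congrArg (fun z => ofDegreeOne (f z)) (moveToLast_castSucc i j)
      have hlp : phiMap (m + 1 - m) (lastPart (moveToLast i) m (fun i => ofDegreeOne (f i))) =
          starG (ofDegreeOne (f i)) := by
        rw [phiMap_eq_starG (by omega)]
        exact congrArg (fun z => starG (ofDegreeOne (f z))) (moveToLast_last i)
      rw [hfirst, hlp, chi_eq_one _ hf, kappa_last, one_mul, zsmul_neg_one_pow (k := k),
        gerstBracket_apply_two]
      exact congrArg _ (gerstBracket_phiOmit hR hm f huv hvw i hc)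
    rw [Finset.sum_congr rfl fun i _ => hlast i, ← Finset.smul_sum, ← smul_add]
    congr 1
    -- The summand t = 1 is the term i = 0; the summand t = m gives all i ≠ 0.
    rw [← Finset.add_sum_erase _ _ (Finset.mem_univ (0 : Fin (m + 1)))]
    congr 1
    have hlp : lastPart (1 : Equiv.Perm (Fin (m + 1))) 1 (fun i => ofDegreeOne (f i)) =
        fun j : Fin m => ofDegreeOne (f ((0 : Fin (m + 1)).succAbove j)) := by
      funext j
      refine congrArg (fun z => ofDegreeOne (f z)) (Fin.ext ?_)
      simp [add_comm]
    rw [phiMap_eq_starG rfl, gerstBracket_apply_two, add_comm, hlp]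
    exact gerstBracket_phiOmit hR hm f huv hvw 0 hc
  · rintro t ⟨ht1, htm⟩
    split_ifs with ht
    -- For the other t both factors are some φ_s with s ≥ 2, so all inner values vanish.
    · refine Finset.sum_eq_zero fun τ _ => ?_
      have h1 : 2 ≤ t.1 := by
        have : t.1 ≠ 1 := fun h => ht1 (Fin.ext h)
        omega
      have h2 : 2 ≤ m + 1 - t.1 := by
        have : t.1 ≠ m := fun h => htm (Fin.ext h)
        omega
      rw [gerstBracket_apply_two,
        gerstProd_eq_zero _ _ _ (phiMap_two_ev hR h1 (fun _ => rfl) huv)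
          (phiMap_two_ev hR h1 (fun _ => rfl) hvw),
        gerstProd_eq_zero _ _ _ (phiMap_two_ev hR h2 (fun _ => rfl) huv)
          (phiMap_two_ev hR h2 (fun _ => rfl) hvw), add_zero, smul_zero]
    · rfl

lemma BzCochain.ev_parallel (f : bardzellCochains k R 2) (w : Word V)
    {p : {p : Word V // NonzeroPath R p}} (hp : p ∈ (BzCochain.ev f.1 w).support) :
    p.1.src = w.src ∧ p.1.tgt = w.tgt := by
  unfold BzCochain.ev at hp
  split_ifs at hp with h
  · exact f.2 ⟨w, h⟩ p hp
  · simp at hp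

/-- A common source of the paths in X lets the vertex idempotents be pulled out of the sum, so that
A can be compared with the value of v_n under the same idempotents. -/
lemma hat_tensorLeft (hR : IsMonomialPresentation R) (g : HochCochain k R 2) {X : Alg k R}
    {x : V} (hX : ∀ p ∈ X.support, p.1.src = x) (b : Word V) :
    g.hat (tensorLeft X b) = sandwich k R x b.tgt (Finsupp.linearCombination k
      (fun p : {p : Word V // NonzeroPath R p} => g.ev x [p.1, b]) X) := by
  simp only [tensorLeft, Finsupp.linearCombination_apply, map_finsuppSum, map_smul]
  refine Finsupp.sum_congr fun p hp => ?_
  rw [hat_oneTensor hR, hX p hp]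
  rfl

lemma hat_tensorRight (hR : IsMonomialPresentation R) (g : HochCochain k R 2) {X : Alg k R}
    {y : V} (hX : ∀ p ∈ X.support, p.1.tgt = y) (a : Word V) :
    g.hat (tensorRight a X) = sandwich k R a.src y (Finsupp.linearCombination k
      (fun p : {p : Word V // NonzeroPath R p} => g.ev a.src [a, p.1]) X) := by
  simp only [tensorRight, Finsupp.linearCombination_apply, map_finsuppSum, map_smul]
  refine Finsupp.sum_congr fun p hp => ?_
  rw [hat_oneTensor hR, ← hX p hp]
  rfl

lemma tgt_comp {p q : Word V} (h : p.tgt = q.src) : (p.comp q).tgt = q.tgt := by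
  rw [Word.tgt, Word.comp, walkEnd_append, Word.tgt, ← h]
  rfl

lemma radChain_of_tame (hR : IsMonomialPresentation R) {α β : Total V} {v : Word V}
    (hv_pos : 1 ≤ v.length) (hα : Tame R ((Word.ofArrow α).comp v))
    (hβ : Tame R (v.comp (Word.ofArrow β))) :
    RadChain R α.left [Word.ofArrow α, v, Word.ofArrow β] := by
  have h1 := (isWalk_append _ _ _).1 hα.1
  have h2 := (isWalk_append _ _ _).1 hβ.1
  have hsrc : v.src = α.right := by
    obtain ⟨a, l, hal⟩ : ∃ a l, v.arrows = a :: l := List.exists_cons_of_length_pos hv_pos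
    have h3 := h1.2
    have h4 := h2.1
    rw [hal] at h3 h4
    exact h4.1.symm.trans h3.1
  -- As a proper suffix of the tame path αv, v is nonzero in A.
  have hvI : ¬ InIdeal R v := by
    have := hα.not_inIdeal_suffix hR (x := α.left) (l := [α]) (l' := v.arrows) (by simp)
    rwa [show (⟨walkEnd α.left [α], v.arrows⟩ : Word V) = v from Word.ext hsrc.symm rfl] at this
  exact ⟨rfl, le_rfl, hR.nonzeroPath_ofArrow α, hsrc, hv_pos, ⟨h2.1, hvI⟩, h2.2.1, le_rfl,
    hR.nonzeroPath_ofArrow β, trivial⟩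

/-- The uniform form of the evaluation of `v_n`. -/
lemma vValue_eq_termA_sub_termB (hR : IsMonomialPresentation R) {m : ℕ} (hm : 2 ≤ m)
    (f : Fin (m + 1) → bardzellCochains k R 2) {α β : Total V} {v : Word V}
    (hv_pos : 1 ≤ v.length) (hα : Tame R ((Word.ofArrow α).comp v))
    (hβ : Tame R (v.comp (Word.ofArrow β))) :
    vValue f α v β = termA f α v β - termB f α v β := by
  have hc := radChain_of_tame hR hv_pos hα hβ
  have htgt : (v.comp (Word.ofArrow β)).tgt = β.right := tgt_comp hc.2.2.2.2.2.2.1.symm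
  have hval := vMap_three_tame hR hm f hα hβ ⟨rfl, hc⟩
  rw [vValue, hat_oneTensor hR, HochCochain.ev, dif_pos ⟨rfl, hc⟩]
  refine (congrArg _ hval).trans ?_
  rw [map_smul, termA, termB, ← smul_sub, ← Finset.sum_sub_distrib, map_sum]
  congr 1
  refine Finset.sum_congr rfl fun i _ => ?_
  -- The values f_i(αv) and f_i(vβ) are parallel to their arguments, so both terms carry the
  -- idempotents at the source of α and the target of β.
  rw [hat_tensorLeft hR (phiOmit f i) (fun p hp => (BzCochain.ev_parallel (f i) _ hp).1),
    hat_tensorRight hR (phiOmit f i)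
      (fun p hp => (BzCochain.ev_parallel (f i) _ hp).2.trans htgt), omitTerm, map_sub]
  rfl

lemma BzCochain.ev_eq_zero_of_not_inIdeal (f : BzCochain k R 2) {w : Word V}
    (hw : ¬ InIdeal R w) : f.ev w = 0 :=
  dif_neg fun h => hw ⟨_, _, relAt_of_mem ((isAP_two_iff h.1).1 h)⟩

lemma termA_eq_zero {m : ℕ} (f : Fin (m + 1) → bardzellCochains k R 2) {α β : Total V}
    {v : Word V} (h : ProdNeZero k R (Word.ofArrow α) v) : termA f α v β = 0 := by
  simp [termA, BzCochain.ev_eq_zero_of_not_inIdeal _ h.nonzeroPath.2, tensorLeft]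

lemma termB_eq_zero {m : ℕ} (f : Fin (m + 1) → bardzellCochains k R 2) {α β : Total V}
    {v : Word V} (h : ProdNeZero k R v (Word.ofArrow β)) : termB f α v β = 0 := by
  simp [termB, BzCochain.ev_eq_zero_of_not_inIdeal _ h.nonzeroPath.2, tensorRight]

end Evaluation

end MonomialAlg

end

theorem proposition4p5 {k : Type*} [Field k] [CharZero k]
    {V : Type*} [Quiver V] [Finite V] [Finite (Quiver.Total V)]
    (R : Set (MonomialAlg.Word V)) (hR : MonomialAlg.IsMonomialPresentation R)
    -- there are `n = m + 1 ≥ 3` elements of `Hom_{E-E}(kAP_2, A)`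
    (m : ℕ) (hm : 3 ≤ m + 1) (f : Fin (m + 1) → MonomialAlg.bardzellCochains k R 2)
    (α β : Quiver.Total V) (v : MonomialAlg.Word V) (hv : v.IsPath) (hv_pos : 1 ≤ v.length) :
    (MonomialAlg.ProdNeZero k R (.ofArrow α) v → MonomialAlg.ProdNeZero k R v (.ofArrow β) →
      MonomialAlg.vValue f α v β = 0) ∧
    ((MonomialAlg.Word.ofArrow α).comp v ∈ R → MonomialAlg.ProdNeZero k R v (.ofArrow β) →
      MonomialAlg.vValue f α v β = MonomialAlg.termA f α v β) ∧
    (MonomialAlg.ProdNeZero k R (.ofArrow α) v → v.comp (MonomialAlg.Word.ofArrow β) ∈ R →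
      MonomialAlg.vValue f α v β = -MonomialAlg.termB f α v β) ∧
    ((MonomialAlg.Word.ofArrow α).comp v ∈ R → v.comp (MonomialAlg.Word.ofArrow β) ∈ R →
      MonomialAlg.vValue f α v β =
        MonomialAlg.termA f α v β - MonomialAlg.termB f α v β) := by
  have hm' : 2 ≤ m := by omega
  refine ⟨fun h1 h2 => ?_, fun h1 h2 => ?_, fun h1 h2 => ?_, fun h1 h2 => ?_⟩
  · rw [MonomialAlg.vValue_eq_termA_sub_termB hR hm' f hv_pos (.of_nonzeroPath h1.nonzeroPath)
      (.of_nonzeroPath h2.nonzeroPath), MonomialAlg.termA_eq_zero f h1,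
      MonomialAlg.termB_eq_zero f h2, sub_zero]
  · rw [MonomialAlg.vValue_eq_termA_sub_termB hR hm' f hv_pos (.of_mem hR h1)
      (.of_nonzeroPath h2.nonzeroPath), MonomialAlg.termB_eq_zero f h2, sub_zero]
  · rw [MonomialAlg.vValue_eq_termA_sub_termB hR hm' f hv_pos (.of_nonzeroPath h1.nonzeroPath)
      (.of_mem hR h2), MonomialAlg.termA_eq_zero f h1, zero_sub]
  · exact MonomialAlg.vValue_eq_termA_sub_termB hR hm' f hv_pos (.of_mem hR h1) (.of_mem hR h2)
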